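/- Let $\kappa>0$, $m>0$ and $a,Q,P\in\mathbb R$, and put $$U=r^2+a^2\cos^2\theta,\quad E_+=1+\kappa^2a^2,\quad \Delta_+(\theta)=1+\kappa^2a^2\cos^2\theta,\quad \Delta_+(r)=(r^2+a^2)(1-\kappa^2r^2)-2mr+Q^2+P^2 .$$ Assume that the spacetime is non-extreme: $\Delta_+(r)$ has three distinct positive roots $0<r_c<r_-<r_+$ (its fourth root is then $-(r_c+r_-+r_+)<0$). The Kerr–Newman–de Sitter metric in Boyer–Lindquist coordinates $(t,r,\theta,\varphi)$ is $g=-e^0\otimes e^0+e^1\otimes e^1+e^2\otimes e^2+e^3\otimes e^3$, where in the exterior region $r_-<r<r_+$ (off the axis, $0<\theta<\pi$) $$e^0=\sqrt{\tfrac{\Delta_+(r)}{U}}\Big(dt-\tfrac{a\sin^2\theta}{E_+}d\varphi\Big),\quad e^1=\sqrt{\tfrac{U}{\Delta_+(r)}}\,dr,\quad e^2=\sqrt{\tfrac{U}{\Delta_+(\theta)}}\,d\theta,\quad e^3=\sqrt{\tfrac{\Delta_+(\theta)}{U}}\sin\theta\Big(a\,dt-\tfrac{r^2+a^2}{E_+}d\varphi\Big),$$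 with dual frame $e_0,\dots,e_3$. The electromagnetic potential is $$A=-\tfrac{Qr}{U}\Big(dt-\tfrac{a\sin^2\theta}{E_+}d\varphi\Big)-\tfrac{P\cos\theta}{U}\Big(a\,dt-\tfrac{r^2+a^2}{E_+}d\varphi\Big).$$ Spinor fields are written as $\mathbb C^4$-valued functions in the spin frame over this frame ($\varphi$ running over $\mathbb R$), and $e^\alpha$ acts by Clifford multiplication through the matrices $$e^0=\begin{pmatrix}0&-I\\-I&0\end{pmatrix},\quad e^j=\begin{pmatrix}0&\sigma^j\\-\sigma^j&0\end{pmatrix},\quad \sigma^1=\begin{pmatrix}-1&0\\0&1\end{pmatrix},\ \sigma^2=\begin{pmatrix}0&1\\1&0\end{pmatrix},\ \sigma^3=\begin{pmatrix}0&i\\-i&0\end{pmatrix}.$$ With $\omega_{\alpha\beta}(X)=g(e_\alpha,\nabla_Xe_\beta)$ for the Levi-Civita connection $\nabla$ of $g$, the spinorial derivative is $\nabla_X\Psi=X(\Psi)-\frac12\sum_{\alpha<\beta}\omega_{\alpha\beta}(X)\,e^\alpha\cdot e^\beta\cdot\Psi$, and the Dirac operator is $\mathscr D\Psi=\sum_\alpha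 e^\alpha\cdot\nabla_{e_\alpha}\Psi$. Let $\lambda,\omega\in\mathbb R$, $k\in\mathbb Z$, and let $X_\pm=X_\pm(r)$, $Y_\pm=Y_\pm(\theta)$ be complex-valued functions. Suppose that, in the exterior region $r_-<r<r_+$, $\Psi$ is a (differentiable) solution of $$\big(\mathscr D+ie^\alpha A(e_\alpha)+i\lambda\big)\Psi=0$$ of the form $\Psi=S_+^{-1}\Phi$, where $$\Phi=e^{-i(\omega t+(k+\frac12)\varphi)}\begin{pmatrix}X_-(r)Y_-(\theta)\\X_+(r)Y_+(\theta)\\X_+(r)Y_-(\theta)\\X_-(r)Y_+(\theta)\end{pmatrix},\qquad S_+=|\Delta_+(r)|^{\frac14}\,\mathrm{diag}\big(\rho^{\frac12},\rho^{\frac12},\bar\rho^{\,\frac12},\bar\rho^{\,\frac12}\big),\quad \rho=r+ia\cos\theta,$$ with principal square roots. Assume the horizon matching condition that $X_+$ or $X_-$ vanishes at the event horizon, i.e. $X_+(r)\to0$ or $X_-(r)\to0$ as $r\downarrow r_-$. Then for every $p\in[2,\infty)$: if $\Psi\in L^p$ on a slice $\{t=\text{const},\ r_1<r<r_+\}$ for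 some $r_1\in(r_-,r_+)$, with respect to the Riemannian volume of the metric induced by $g$ on the slice and the standard Hermitian norm on $\mathbb C^4$, then $\Psi\equiv0$ in the exterior region. -/

import Mathlib

open MeasureTheory Filter Topology

noncomputable section

/-- The real parameters of a Kerr-Newman-de Sitter spacetime: `3 * kappa ^ 2` is the cosmological
constant, `m` the mass, `a` the rotation parameter, `Q` and `P` the electric and magnetic charge.
Points of the coordinate chart are `x : Fin 4 → ℝ` with Boyer-Lindquist coordinates
`x 0 = t`, `x 1 = r`, `x 2 = θ`, `x 3 = φ`; tangent vectors are given by their components with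
respect to `∂_t, ∂_r, ∂_θ, ∂_φ`. -/
structure KNdS where
  (kappa m a Q P : ℝ)

namespace KNdS

variable (s : KNdS)

/-! ### The metric and the electromagnetic potential -/

/-- `U = r² + a² cos² θ`. -/
def U (r θ : ℝ) : ℝ := r ^ 2 + s.a ^ 2 * Real.cos θ ^ 2

/-- `E₊ = 1 + κ² a²`. -/
def E : ℝ := 1 + s.kappa ^ 2 * s.a ^ 2

/-- `Δ₊(r) = (r² + a²)(1 - κ² r²) - 2 m r + Q² + P²`. -/
def radialDelta (r : ℝ) : ℝ :=
  (r ^ 2 + s.a ^ 2) * (1 - s.kappa ^ 2 * r ^ 2) - 2 * s.m * r + s.Q ^ 2 + s.P ^ 2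

/-- `Δ₊(θ) = 1 + κ² a² cos² θ`. -/
def angularDelta (θ : ℝ) : ℝ := 1 + s.kappa ^ 2 * s.a ^ 2 * Real.cos θ ^ 2

/-- The 1-form `dt - (a sin² θ / E₊) dφ`. -/
def formB (x v : Fin 4 → ℝ) : ℝ := v 0 - s.a * Real.sin (x 2) ^ 2 / s.E * v 3

/-- The 1-form `a dt - ((r² + a²) / E₊) dφ`. -/
def formC (x v : Fin 4 → ℝ) : ℝ := s.a * v 0 - (x 1 ^ 2 + s.a ^ 2) / s.E * v 3

/-- The Kerr-Newman-de Sitter metric in Boyer-Lindquist coordinates. -/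
def metric (x v w : Fin 4 → ℝ) : ℝ :=
  -(s.radialDelta (x 1) / s.U (x 1) (x 2)) * (s.formB x v * s.formB x w)
    + s.U (x 1) (x 2) / s.radialDelta (x 1) * (v 1 * w 1)
    + s.U (x 1) (x 2) / s.angularDelta (x 2) * (v 2 * w 2)
    + s.angularDelta (x 2) * Real.sin (x 2) ^ 2 / s.U (x 1) (x 2) * (s.formC x v * s.formC x w)

/-- The electromagnetic potential 1-form `A`. -/
def potential (x v : Fin 4 → ℝ) : ℝ :=
  -(s.Q * x 1 / s.U (x 1) (x 2)) * s.formB x v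
    - s.P * Real.cos (x 2) / s.U (x 1) (x 2) * s.formC x v

/-- The spacetime is non-extreme, with Cauchy horizon `rc`, event horizon `rm` and cosmological
horizon `rp`: these are three distinct positive roots of `Δ₊(r)`. As `Δ₊(r)` is a quartic without
cubic term, its fourth root is then the negative number `-(rc + rm + rp)`. -/
structure IsNonExtreme (rc rm rp : ℝ) : Prop where
  kappa_pos : 0 < s.kappa
  m_pos : 0 < s.m
  rc_pos : 0 < rc
  rc_lt_rm : rc < rm
  rm_lt_rp : rm < rp
  root_rc : s.radialDelta rc = 0
  root_rm : s.radialDelta rm = 0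
  root_rp : s.radialDelta rp = 0

/-- The exterior region `rm < r < rp` (off the axis, where the chart and the frame below are
defined; `φ` runs over the universal cover `ℝ` of the circle). -/
def exterior (rm rp : ℝ) : Set (Fin 4 → ℝ) :=
  {x | rm < x 1 ∧ x 1 < rp ∧ 0 < x 2 ∧ x 2 < Real.pi}

/-! ### The orthonormal frame and the Levi-Civita connection -/

/-- The orthonormal frame `e₀, e₁, e₂, e₃`, with `e₀` timelike. -/
def frame : Fin 4 → (Fin 4 → ℝ) → (Fin 4 → ℝ)
  | 0, x =>
      (√(s.U (x 1) (x 2) * s.radialDelta (x 1)))⁻¹ • ![x 1 ^ 2 + s.a ^ 2, 0, 0, s.a * s.E]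
  | 1, x => √(s.radialDelta (x 1) / s.U (x 1) (x 2)) • ![0, 1, 0, 0]
  | 2, x => √(s.angularDelta (x 2) / s.U (x 1) (x 2)) • ![0, 0, 1, 0]
  | 3, x =>
      -(√(s.U (x 1) (x 2) * s.angularDelta (x 2)))⁻¹ •
        ![s.a * Real.sin (x 2), 0, 0, s.E / Real.sin (x 2)]

/-- `g(∇_X Y, Z)` for the Levi-Civita connection `∇` of the metric, by the Koszul formula. -/
def leviCivita (X Y Z : (Fin 4 → ℝ) → (Fin 4 → ℝ)) (x : Fin 4 → ℝ) : ℝ :=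
  1 / 2 *
    (fderiv ℝ (fun y => s.metric y (Y y) (Z y)) x (X x)
      + fderiv ℝ (fun y => s.metric y (X y) (Z y)) x (Y x)
      - fderiv ℝ (fun y => s.metric y (X y) (Y y)) x (Z x)
      + s.metric x (VectorField.lieBracket ℝ X Y x) (Z x)
      - s.metric x (VectorField.lieBracket ℝ X Z x) (Y x)
      - s.metric x (VectorField.lieBracket ℝ Y Z x) (X x))

/-- The connection coefficient `ω_{αβ}(e_γ) = g(e_α, ∇_{e_γ} e_β)`. -/
def connection (α β γ : Fin 4) (x : Fin 4 → ℝ) : ℝ :=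
  s.leviCivita (s.frame γ) (s.frame β) (s.frame α) x

end KNdS

/-! ### Spinors and the Dirac equation -/

/-- Clifford multiplication by the coframe covector `e^α`: the representation with
`e⁰ e⁰ = 1`, `eʲ eʲ = -1` for `j = 1, 2, 3`, and `e^α e^β = - e^β e^α` for `α ≠ β`. -/
def cliffordMatrix : Fin 4 → Matrix (Fin 4) (Fin 4) ℂ
  | 0 => !![0, 0, -1, 0; 0, 0, 0, -1; -1, 0, 0, 0; 0, -1, 0, 0]
  | 1 => !![0, 0, -1, 0; 0, 0, 0, 1; 1, 0, 0, 0; 0, -1, 0, 0]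
  | 2 => !![0, 0, 0, 1; 0, 0, 1, 0; 0, -1, 0, 0; -1, 0, 0, 0]
  | 3 => !![0, 0, 0, Complex.I; 0, 0, -Complex.I, 0; 0, -Complex.I, 0, 0; Complex.I, 0, 0, 0]

namespace KNdS

variable (s : KNdS)

/-- The spinorial Levi-Civita derivative
`∇_{e_γ} Ψ = e_γ(Ψ) - 1/2 ∑_{α < β} ω_{αβ}(e_γ) e^α · e^β · Ψ`
of a spinor field, written as a `ℂ⁴`-valued function in the spin frame over the frame above. -/
def spinDeriv (γ : Fin 4) (ψ : (Fin 4 → ℝ) → (Fin 4 → ℂ)) (x : Fin 4 → ℝ) : Fin 4 → ℂ :=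
  fderiv ℝ ψ x (s.frame γ x)
    - (1 / 2 : ℂ) • ∑ α : Fin 4, ∑ β ∈ Finset.Ioi α,
        (s.connection α β γ x : ℂ) • (cliffordMatrix α * cliffordMatrix β).mulVec (ψ x)

/-- The Dirac operator `𝒟 Ψ = e^α · ∇_{e_α} Ψ`. -/
def diracOp (ψ : (Fin 4 → ℝ) → (Fin 4 → ℂ)) (x : Fin 4 → ℝ) : Fin 4 → ℂ :=
  ∑ α : Fin 4, (cliffordMatrix α).mulVec (s.spinDeriv α ψ x)

/-- `Ψ` is a (classical) solution of `(𝒟 + i e^α A(e_α) + i λ) Ψ = 0` in the exterior region. -/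
def IsDiracSolution (rm rp lam : ℝ) (ψ : (Fin 4 → ℝ) → (Fin 4 → ℂ)) : Prop :=
  ∀ x ∈ exterior rm rp, DifferentiableAt ℝ ψ x ∧
    s.diracOp ψ x
      + Complex.I • ∑ α : Fin 4,
          (s.potential x (s.frame α x) : ℂ) • (cliffordMatrix α).mulVec (ψ x)
      + (Complex.I * (lam : ℂ)) • ψ x = 0

/-! ### Separated time-periodic spinors -/

/-- The diagonal matrix `S₊`; the square roots are principal branches. -/
def matrixS (r θ : ℝ) : Matrix (Fin 4) (Fin 4) ℂ :=
  ((|s.radialDelta r| ^ (1 / 4 : ℝ) : ℝ) : ℂ) •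
    Matrix.diagonal
      ![((r : ℂ) + Complex.I * s.a * Real.cos θ) ^ (1 / 2 : ℂ),
        ((r : ℂ) + Complex.I * s.a * Real.cos θ) ^ (1 / 2 : ℂ),
        ((r : ℂ) - Complex.I * s.a * Real.cos θ) ^ (1 / 2 : ℂ),
        ((r : ℂ) - Complex.I * s.a * Real.cos θ) ^ (1 / 2 : ℂ)]

/-- `Φ = e^{-i(ωt + (k + 1/2)φ)} (X₋Y₋, X₊Y₊, X₊Y₋, X₋Y₊)`. -/
def separatedPhi (ω : ℝ) (k : ℤ) (Xp Xm Yp Ym : ℝ → ℂ) (x : Fin 4 → ℝ) : Fin 4 → ℂ :=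
  Complex.exp (-Complex.I * ((ω : ℂ) * (x 0 : ℂ) + ((k : ℂ) + 1 / 2) * (x 3 : ℂ))) •
    ![Xm (x 1) * Ym (x 2), Xp (x 1) * Yp (x 2), Xp (x 1) * Ym (x 2), Xm (x 1) * Yp (x 2)]

/-- `Ψ = S₊⁻¹ Φ` in the exterior region. -/
def IsSeparated (rm rp ω : ℝ) (k : ℤ) (Xp Xm Yp Ym : ℝ → ℂ)
    (ψ : (Fin 4 → ℝ) → (Fin 4 → ℂ)) : Prop :=
  ∀ x ∈ exterior rm rp,
    ψ x = (s.matrixS (x 1) (x 2))⁻¹.mulVec (separatedPhi ω k Xp Xm Yp Ym x)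

/-! ### `L^p` integrability on a time slice -/

/-- The point with coordinates `(t₀, r, θ, φ)` of the slice `t = t₀`, where `y = (r, θ, φ)`. -/
def slicePoint (t₀ : ℝ) (y : ℝ × ℝ × ℝ) : Fin 4 → ℝ := ![t₀, y.1, y.2.1, y.2.2]

/-- The Riemannian volume density `√det (g_{ij})`, `i, j ∈ {r, θ, φ}`, of the metric induced on
the slice `t = t₀`. -/
def sliceDensity (t₀ : ℝ) (y : ℝ × ℝ × ℝ) : ℝ :=
  √(Matrix.det (Matrix.of fun i j : Fin 3 =>
    s.metric (slicePoint t₀ y) (Pi.single i.succ 1) (Pi.single j.succ 1)))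

/-- The induced Riemannian volume measure of the slice `{t = t₀, r₁ < r < rp}`. -/
def sliceMeasure (t₀ r₁ rp : ℝ) : Measure (ℝ × ℝ × ℝ) :=
  (volume.restrict (Set.Ioo r₁ rp ×ˢ Set.Ioo 0 Real.pi ×ˢ Set.Ioo 0 (2 * Real.pi))).withDensity
    fun y => ENNReal.ofReal (s.sliceDensity t₀ y)

/-- `Ψ ∈ L^p` on the slice `{t = t₀, r₁ < r < rp}`, for the standard Hermitian norm on `ℂ⁴`. -/
def IsLpOnSlice (p t₀ r₁ rp : ℝ) (ψ : (Fin 4 → ℝ) → (Fin 4 → ℂ)) : Prop :=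
  MemLp (fun y => (WithLp.toLp 2 (ψ (slicePoint t₀ y)) : EuclideanSpace ℂ (Fin 4)))
    (ENNReal.ofReal p) (s.sliceMeasure t₀ r₁ rp)

/-- Horizon matching condition: `X₊` or `X₋` vanishes at the event horizon `r = rm` (as a limit
from the exterior, where the radial functions are defined). -/
def HorizonMatching (rm : ℝ) (Xp Xm : ℝ → ℂ) : Prop :=
  Tendsto Xp (𝓝[>] rm) (𝓝 0) ∨ Tendsto Xm (𝓝[>] rm) (𝓝 0)

end KNdS

end

/-!
A separated solution that does not vanish identically cannot be `L^p` near the cosmological horizon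
`r = rp`: it does not decay there, while the volume density of the slice blows up.

*Geometry.* The frame is orthonormal, so the Koszul formula expresses its connection coefficients
through the commutators of the frame (`KNdS.IsRegular.connection_eq`). In the chiral representation
at hand, row `j` of the Dirac operator (components being counted modulo `4`) involves the radial
derivative of the component `j + 2` only, and the angular derivatives of the component `3 - j` only
(`KNdS.IsRegular.diracOp_apply`). After division by `√(Δ₊/U)`, the only real
coefficient that is not `O((rp - r)^{-1/2})` is `Δ₊' / (4 Δ₊)`; it is compensated by the weight
`Δ₊^{1/4}`.

*Radial equation.* Fix a meridian on which the angular factor of the component `j` does not vanish.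
The components `j` and `3 - j` have the same radial factor, so on this meridian the component `3 - j`
and its `θ`-derivative are bounded by a multiple of the component `j`
(`KNdS.IsSeparated.exists_norm_rev_le`). Rows `j` and `j + 2` of the Dirac equation thus become a
closed radial system for the components `j + 2` and `j`; apart from a diagonal part
`-Δ₊' / (4 Δ₊) + i h` with `h` real its coefficients are `O((rp - r)^{-1/2})`, which is integrable
(`KNdS.exists_norm_radial_le_div_sqrt`). A Grönwall argument (`le_sqrt_mul_norm_sq_add_norm_sq`)
shows that `|X₊|² + |X₋|²` is bounded below by a positive constant as `r ↑ rp`, provided that it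
is nonzero at one point (`KNdS.exists_le_norm_radialFactor`). No separation constant is needed, and
the coefficients of the two rows need not be related.

*Divergence.* Consequently `|Ψ|² ≥ c (rp - r)^{-1/2}` on a box that touches the cosmological horizon,
and the volume density is at least `d (rp - r)^{-1/2}` (`KNdS.IsNonExtreme.exists_le_sliceDensity`).
For `p ≥ 2` the integral of `|Ψ|^p` therefore dominates that of `(rp - r)^{-1}`, which diverges
(`not_memLp_of_le_norm_sq`).
-/

noncomputable section

namespace KNdS
variable (s : KNdS)

/-! ### Positivity in the exterior region -/

theorem E_pos : 0 < s.E := by unfold E; positivity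

theorem angularDelta_pos (θ : ℝ) : 0 < s.angularDelta θ := by unfold angularDelta; positivity

theorem U_pos {r : ℝ} (hr : 0 < r) (θ : ℝ) : 0 < s.U r θ := by unfold U; positivity

/-- A quartic without cubic term is determined by its leading coefficient and three distinct
roots. -/
theorem IsNonExtreme.radialDelta_eq {s : KNdS} {rc rm rp : ℝ} (hs : s.IsNonExtreme rc rm rp)
    (r : ℝ) : s.radialDelta r =
      s.kappa ^ 2 * (rp - r) * (r - rm) * (r - rc) * (r + (rc + rm + rp)) := by
  obtain ⟨-, -, -, h1, h2, e1, e2, e3⟩ := hs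
  have n1 : rm - rc ≠ 0 := by linarith
  have n2 : rp - rm ≠ 0 := by linarith
  have n3 : rp - rc ≠ 0 := by linarith
  unfold radialDelta at *
  -- The difference of both sides is quadratic in `r` and vanishes at `rc`, `rm` and `rp`: its
  -- divided differences of second, first and zeroth order are zero.
  set c0 := s.a ^ 2 + s.Q ^ 2 + s.P ^ 2 with hc0
  set k := s.kappa ^ 2 with hk
  have d1 : -k * (rm ^ 3 + rm ^ 2 * rc + rm * rc ^ 2 + rc ^ 3)
      + (1 - k * s.a ^ 2) * (rm + rc) - 2 * s.m = 0 := by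
    apply mul_left_cancel₀ n1; linear_combination e2 - e1
  have d2 : -k * (rp ^ 3 + rp ^ 2 * rm + rp * rm ^ 2 + rm ^ 3)
      + (1 - k * s.a ^ 2) * (rp + rm) - 2 * s.m = 0 := by
    apply mul_left_cancel₀ n2; linear_combination e3 - e2
  have d3 : -k * (rp ^ 2 + rm ^ 2 + rc ^ 2 + rp * rm + rp * rc + rm * rc)
      + (1 - k * s.a ^ 2) = 0 := by
    apply mul_left_cancel₀ n3; linear_combination d2 - d1
  linear_combination e1 + (r - rc) * d1 + (r - rc) * (r - rm) * d3

theorem IsNonExtreme.radialDelta_pos {s : KNdS} {rc rm rp : ℝ} (hs : s.IsNonExtreme rc rm rp)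
    {r : ℝ} (h1 : rm < r) (h2 : r < rp) : 0 < s.radialDelta r := by
  rw [hs.radialDelta_eq]
  have := hs.kappa_pos
  have := hs.rc_pos
  have := hs.rc_lt_rm
  have a1 : 0 < rp - r := by linarith
  have a2 : 0 < r - rm := by linarith
  have a3 : 0 < r - rc := by linarith
  have a4 : 0 < r + (rc + rm + rp) := by linarith
  positivity

/-- The points of the chart at which the frame is smooth and orthonormal. -/
structure IsRegular (x : Fin 4 → ℝ) : Prop where
  r_pos : 0 < x 1
  radialDelta_pos : 0 < s.radialDelta (x 1)
  sin_pos : 0 < Real.sin (x 2)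

theorem IsNonExtreme.isRegular {s : KNdS} {rc rm rp : ℝ} (hs : s.IsNonExtreme rc rm rp)
    {x : Fin 4 → ℝ} (hx : x ∈ exterior rm rp) : s.IsRegular x :=
  ⟨(hs.rc_pos.trans hs.rc_lt_rm).trans hx.1, hs.radialDelta_pos hx.1 hx.2.1,
    Real.sin_pos_of_pos_of_lt_pi hx.2.2.1 hx.2.2.2⟩

variable {s} in
theorem IsRegular.U_pos {x : Fin 4 → ℝ} (hx : s.IsRegular x) : 0 < s.U (x 1) (x 2) :=
  s.U_pos hx.r_pos _

variable {s} in
theorem IsRegular.eventually {x : Fin 4 → ℝ} (hx : s.IsRegular x) :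
    ∀ᶠ y in 𝓝 x, s.IsRegular y := by
  have h1 : Continuous fun y : Fin 4 → ℝ => y 1 := continuous_apply 1
  have h2 : Continuous fun y : Fin 4 → ℝ => s.radialDelta (y 1) := by
    unfold radialDelta; fun_prop
  have h3 : Continuous fun y : Fin 4 → ℝ => Real.sin (y 2) := by fun_prop
  filter_upwards [h1.continuousAt.eventually_const_lt hx.1, h2.continuousAt.eventually_const_lt hx.2,
    h3.continuousAt.eventually_const_lt hx.3] with y a b c using ⟨a, b, c⟩

/-! ### Derivatives of the frame -/

/-- The derivative of `Δ₊(r)`. -/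
def radialDeltaDeriv (r : ℝ) : ℝ :=
  2 * r * (1 - s.kappa ^ 2 * r ^ 2) - 2 * s.kappa ^ 2 * r * (r ^ 2 + s.a ^ 2) - 2 * s.m

theorem hasDerivAt_radialDelta (r : ℝ) :
    HasDerivAt s.radialDelta (s.radialDeltaDeriv r) r := by
  unfold radialDelta radialDeltaDeriv
  have h := (((((hasDerivAt_id r).pow 2).add_const (s.a ^ 2)).mul
    ((((hasDerivAt_id r).pow 2).const_mul (s.kappa ^ 2)).const_sub 1)).sub
    ((hasDerivAt_id r).const_mul (2 * s.m))).add_const (s.Q ^ 2) |>.add_const (s.P ^ 2)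
  refine h.congr_deriv ?_
  simp
  ring

/-- The differential of `U` as a function on the chart. -/
def dU (x v : Fin 4 → ℝ) : ℝ :=
  2 * x 1 * v 1 - 2 * s.a ^ 2 * Real.cos (x 2) * Real.sin (x 2) * v 2

/-- The differential of `Δ₊(θ)` as a function on the chart. -/
def dAngularDelta (x v : Fin 4 → ℝ) : ℝ :=
  -(2 * s.kappa ^ 2 * s.a ^ 2 * Real.cos (x 2) * Real.sin (x 2)) * v 2

theorem hasFDerivAt_coord (i : Fin 4) (x : Fin 4 → ℝ) :
    HasFDerivAt (fun y : Fin 4 → ℝ => y i) (ContinuousLinearMap.proj (R := ℝ) i) x :=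
  (ContinuousLinearMap.proj (R := ℝ) (φ := fun _ : Fin 4 => ℝ) i).hasFDerivAt

theorem hasFDerivAt_U (x : Fin 4 → ℝ) :
    ∃ D : (Fin 4 → ℝ) →L[ℝ] ℝ,
      HasFDerivAt (fun y : Fin 4 → ℝ => s.U (y 1) (y 2)) D x ∧ ∀ v, D v = s.dU x v := by
  refine ⟨_, ((hasFDerivAt_coord 1 x).pow 2).add
    (((hasFDerivAt_coord 2 x).cos.pow 2).const_mul (s.a ^ 2)), fun v => ?_⟩
  simp [dU]
  ring

theorem hasFDerivAt_radialDelta (x : Fin 4 → ℝ) :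
    ∃ D : (Fin 4 → ℝ) →L[ℝ] ℝ,
      HasFDerivAt (fun y : Fin 4 → ℝ => s.radialDelta (y 1)) D x ∧
        ∀ v, D v = s.radialDeltaDeriv (x 1) * v 1 :=
  ⟨s.radialDeltaDeriv (x 1) • ContinuousLinearMap.proj 1,
    HasDerivAt.comp_hasFDerivAt (f := fun y : Fin 4 → ℝ => y 1) x
      (s.hasDerivAt_radialDelta (x 1)) (hasFDerivAt_coord 1 x), fun _ => rfl⟩

theorem hasFDerivAt_angularDelta (x : Fin 4 → ℝ) :
    ∃ D : (Fin 4 → ℝ) →L[ℝ] ℝ,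
      HasFDerivAt (fun y : Fin 4 → ℝ => s.angularDelta (y 2)) D x ∧
        ∀ v, D v = s.dAngularDelta x v := by
  refine ⟨_, (((hasFDerivAt_coord 2 x).cos.pow 2).const_mul (s.kappa ^ 2 * s.a ^ 2)).const_add 1,
    fun v => ?_⟩
  simp [dAngularDelta]
  ring

/-- The derivative of `√f` in terms of the logarithmic derivative of `f`, which keeps the derivative
of each frame vector a multiple of that vector. -/
theorem hasFDerivAt_sqrt_log {F : Type*} [NormedAddCommGroup F] [NormedSpace ℝ F] {f : F → ℝ}
    {D : F →L[ℝ] ℝ} {x : F} (hf : HasFDerivAt f D x) (h0 : 0 < f x) :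
    HasFDerivAt (fun y => √(f y)) ((√(f x) / (2 * f x)) • D) x := by
  refine (hf.sqrt h0.ne').congr_fderiv ?_
  congr 1
  have := Real.sqrt_pos.2 h0
  field_simp
  rw [Real.sq_sqrt h0.le]

theorem hasFDerivAt_sqrt_inv_log {F : Type*} [NormedAddCommGroup F] [NormedSpace ℝ F] {f : F → ℝ}
    {D : F →L[ℝ] ℝ} {x : F} (hf : HasFDerivAt f D x) (h0 : 0 < f x) :
    HasFDerivAt (fun y => (√(f y))⁻¹) ((-(√(f x))⁻¹ / (2 * f x)) • D) x := by
  have := Real.sqrt_pos.2 h0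
  refine ((hasDerivAt_inv this.ne').comp_hasFDerivAt x (hf.sqrt h0.ne')).congr_fderiv ?_
  rw [smul_smul]
  congr 1
  field_simp
  rw [Real.sq_sqrt h0.le]

theorem hasFDerivAt_div_real {F : Type*} [NormedAddCommGroup F] [NormedSpace ℝ F] {f g : F → ℝ}
    {D D' : F →L[ℝ] ℝ} {x : F} (hf : HasFDerivAt f D x) (hg : HasFDerivAt g D' x)
    (h0 : g x ≠ 0) :
    HasFDerivAt (fun y => f y / g y) ((g x)⁻¹ • D - (f x / g x ^ 2) • D') x := by
  refine HasFDerivAt.congr_fderiv (f := fun y => f y / g y)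
    (hf.mul ((hasDerivAt_inv h0).comp_hasFDerivAt x hg)) ?_
  ext v
  simp
  ring

variable {s} in
/-- The derivative of `e₀` consists of a multiple of `e₀`, from the normalising factor, and a multiple
of `∂_t`. -/
theorem IsRegular.hasFDerivAt_frame_zero {x : Fin 4 → ℝ} (hx : s.IsRegular x) :
    ∃ D : (Fin 4 → ℝ) →L[ℝ] (Fin 4 → ℝ), HasFDerivAt (s.frame 0) D x ∧
      ∀ v, D v = (-(s.dU x v / (2 * s.U (x 1) (x 2))
          + s.radialDeltaDeriv (x 1) * v 1 / (2 * s.radialDelta (x 1)))) • s.frame 0 x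
        + (√(s.U (x 1) (x 2) * s.radialDelta (x 1)))⁻¹ • ![2 * x 1 * v 1, 0, 0, 0] := by
  obtain ⟨D1, h1, e1⟩ := s.hasFDerivAt_U x
  obtain ⟨D2, h2, e2⟩ := s.hasFDerivAt_radialDelta x
  have hU := hx.U_pos
  have hD := hx.radialDelta_pos
  have hA := hasFDerivAt_sqrt_inv_log (h1.mul h2) (mul_pos hU hD)
  have hw : HasFDerivAt (fun y : Fin 4 → ℝ => ![y 1 ^ 2 + s.a ^ 2, 0, 0, s.a * s.E])
      (ContinuousLinearMap.pi ![(2 * x 1) • ContinuousLinearMap.proj (R := ℝ) 1, 0, 0, 0]) x := by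
    rw [hasFDerivAt_pi']
    intro i
    fin_cases i
    · refine (((hasFDerivAt_coord 1 x).pow 2).add_const (s.a ^ 2)).congr_fderiv ?_
      ext v
      simp
    all_goals exact (hasFDerivAt_const _ x)
  refine ⟨_, hA.smul hw, fun v => ?_⟩
  have hq := Real.sqrt_pos.2 (mul_pos hU hD)
  ext i
  fin_cases i <;> simp [frame, e1, e2] <;> field_simp <;> ring

variable {s} in
theorem IsRegular.hasFDerivAt_frame_one {x : Fin 4 → ℝ} (hx : s.IsRegular x) :
    ∃ D : (Fin 4 → ℝ) →L[ℝ] (Fin 4 → ℝ), HasFDerivAt (s.frame 1) D x ∧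
      ∀ v, D v = (s.radialDeltaDeriv (x 1) * v 1 / (2 * s.radialDelta (x 1))
        - s.dU x v / (2 * s.U (x 1) (x 2))) • s.frame 1 x := by
  obtain ⟨D1, h1, e1⟩ := s.hasFDerivAt_U x
  obtain ⟨D2, h2, e2⟩ := s.hasFDerivAt_radialDelta x
  have hU := hx.U_pos
  have hD := hx.radialDelta_pos
  have hA := hasFDerivAt_sqrt_log (hasFDerivAt_div_real h2 h1 hU.ne') (div_pos hD hU)
  refine ⟨_, hA.smul_const ![0, 1, 0, 0], fun v => ?_⟩
  have hq := Real.sqrt_pos.2 (div_pos hD hU)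
  ext i
  fin_cases i <;> (simp [frame, e1, e2]; try field_simp)

variable {s} in
theorem IsRegular.hasFDerivAt_frame_two {x : Fin 4 → ℝ} (hx : s.IsRegular x) :
    ∃ D : (Fin 4 → ℝ) →L[ℝ] (Fin 4 → ℝ), HasFDerivAt (s.frame 2) D x ∧
      ∀ v, D v = (s.dAngularDelta x v / (2 * s.angularDelta (x 2))
        - s.dU x v / (2 * s.U (x 1) (x 2))) • s.frame 2 x := by
  obtain ⟨D1, h1, e1⟩ := s.hasFDerivAt_U x
  obtain ⟨D2, h2, e2⟩ := s.hasFDerivAt_angularDelta x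
  have hU := hx.U_pos
  have hD := s.angularDelta_pos (x 2)
  have hA := hasFDerivAt_sqrt_log (hasFDerivAt_div_real h2 h1 hU.ne') (div_pos hD hU)
  refine ⟨_, hA.smul_const ![0, 0, 1, 0], fun v => ?_⟩
  have hq := Real.sqrt_pos.2 (div_pos hD hU)
  ext i
  fin_cases i <;> (simp [frame, e1, e2]; try field_simp)

variable {s} in
theorem IsRegular.hasFDerivAt_frame_three {x : Fin 4 → ℝ} (hx : s.IsRegular x) :
    ∃ D : (Fin 4 → ℝ) →L[ℝ] (Fin 4 → ℝ), HasFDerivAt (s.frame 3) D x ∧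
      ∀ v, D v = (-(s.dU x v / (2 * s.U (x 1) (x 2))
          + s.dAngularDelta x v / (2 * s.angularDelta (x 2)))) • s.frame 3 x
        - (√(s.U (x 1) (x 2) * s.angularDelta (x 2)))⁻¹ •
          ![s.a * Real.cos (x 2) * v 2, 0, 0,
            -(s.E * Real.cos (x 2) / Real.sin (x 2) ^ 2) * v 2] := by
  obtain ⟨D1, h1, e1⟩ := s.hasFDerivAt_U x
  obtain ⟨D2, h2, e2⟩ := s.hasFDerivAt_angularDelta x
  have hU := hx.U_pos
  have hD := s.angularDelta_pos (x 2)
  have hs := hx.sin_pos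
  have hA := hasFDerivAt_sqrt_inv_log (h1.mul h2) (mul_pos hU hD)
  have hw : HasFDerivAt (fun y : Fin 4 → ℝ => ![s.a * Real.sin (y 2), 0, 0, s.E / Real.sin (y 2)])
      (ContinuousLinearMap.pi ![(s.a * Real.cos (x 2)) • ContinuousLinearMap.proj (R := ℝ) 2, 0, 0,
        (-(s.E * Real.cos (x 2) / Real.sin (x 2) ^ 2)) • ContinuousLinearMap.proj (R := ℝ) 2])
      x := by
    rw [hasFDerivAt_pi']
    intro i
    fin_cases i
    · refine ((hasFDerivAt_coord 2 x).sin.const_mul s.a).congr_fderiv ?_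
      ext v
      simp
      ring
    · exact (hasFDerivAt_const _ x)
    · exact (hasFDerivAt_const _ x)
    · have := ((hasDerivAt_inv hs.ne').comp_hasFDerivAt x (hasFDerivAt_coord 2 x).sin).const_mul s.E
      refine HasFDerivAt.congr_fderiv (f := fun y : Fin 4 → ℝ => s.E / Real.sin (y 2)) this ?_
      ext v
      simp
      field_simp
  refine ⟨_, hA.neg.smul hw, fun v => ?_⟩
  have hq := Real.sqrt_pos.2 (mul_pos hU hD)
  ext i
  fin_cases i <;> simp [frame, e1, e2] <;> field_simp <;> ring
end KNdS

namespace KNdS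
variable (s : KNdS)

/-! ### Structure functions of the frame -/

/-- `√(Δ₊(r) / U)`, the `r`-component of `e₁`. -/
def radialSpeed (x : Fin 4 → ℝ) : ℝ := √(s.radialDelta (x 1) / s.U (x 1) (x 2))

/-- `√(Δ₊(θ) / U)`, the `θ`-component of `e₂`. -/
def angularSpeed (x : Fin 4 → ℝ) : ℝ := √(s.angularDelta (x 2) / s.U (x 1) (x 2))

variable {s} {x : Fin 4 → ℝ}

theorem IsRegular.radialSpeed_pos (hx : s.IsRegular x) : 0 < s.radialSpeed x :=
  Real.sqrt_pos.2 (div_pos hx.radialDelta_pos hx.U_pos)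

theorem IsRegular.angularSpeed_pos (hx : s.IsRegular x) : 0 < s.angularSpeed x :=
  Real.sqrt_pos.2 (div_pos (s.angularDelta_pos _) hx.U_pos)

theorem IsRegular.radialDelta_eq (hx : s.IsRegular x) :
    s.radialDelta (x 1) = s.radialSpeed x ^ 2 * s.U (x 1) (x 2) := by
  rw [radialSpeed, Real.sq_sqrt (div_pos hx.radialDelta_pos hx.U_pos).le,
    div_mul_cancel₀ _ hx.U_pos.ne']

theorem IsRegular.angularDelta_eq (hx : s.IsRegular x) :
    s.angularDelta (x 2) = s.angularSpeed x ^ 2 * s.U (x 1) (x 2) := by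
  rw [angularSpeed, Real.sq_sqrt (div_pos (s.angularDelta_pos _) hx.U_pos).le,
    div_mul_cancel₀ _ hx.U_pos.ne']

theorem IsRegular.frame_zero (hx : s.IsRegular x) : s.frame 0 x =
    (s.U (x 1) (x 2) * s.radialSpeed x)⁻¹ • ![x 1 ^ 2 + s.a ^ 2, 0, 0, s.a * s.E] := by
  have hU := hx.U_pos
  have hR := hx.radialSpeed_pos
  rw [frame, hx.radialDelta_eq,
    show s.U (x 1) (x 2) * (s.radialSpeed x ^ 2 * s.U (x 1) (x 2))
      = (s.U (x 1) (x 2) * s.radialSpeed x) ^ 2 by ring, Real.sqrt_sq (by positivity)]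

theorem frame_one (s : KNdS) (x : Fin 4 → ℝ) :
    s.frame 1 x = s.radialSpeed x • ![0, 1, 0, 0] := rfl

theorem frame_two (s : KNdS) (x : Fin 4 → ℝ) :
    s.frame 2 x = s.angularSpeed x • ![0, 0, 1, 0] := rfl

theorem IsRegular.frame_three (hx : s.IsRegular x) : s.frame 3 x =
    -(s.U (x 1) (x 2) * s.angularSpeed x)⁻¹ •
      ![s.a * Real.sin (x 2), 0, 0, s.E / Real.sin (x 2)] := by
  have hU := hx.U_pos
  have hR := hx.angularSpeed_pos
  rw [frame, hx.angularDelta_eq,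
    show s.U (x 1) (x 2) * (s.angularSpeed x ^ 2 * s.U (x 1) (x 2))
      = (s.U (x 1) (x 2) * s.angularSpeed x) ^ 2 by ring, Real.sqrt_sq (by positivity)]

theorem IsRegular.sqrt_U_mul_radialDelta (hx : s.IsRegular x) :
    √(s.U (x 1) (x 2) * s.radialDelta (x 1)) = s.U (x 1) (x 2) * s.radialSpeed x := by
  have hU := hx.U_pos
  have hR := hx.radialSpeed_pos
  rw [hx.radialDelta_eq, show s.U (x 1) (x 2) * (s.radialSpeed x ^ 2 * s.U (x 1) (x 2))
      = (s.U (x 1) (x 2) * s.radialSpeed x) ^ 2 by ring, Real.sqrt_sq (by positivity)]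

theorem IsRegular.sqrt_U_mul_angularDelta (hx : s.IsRegular x) :
    √(s.U (x 1) (x 2) * s.angularDelta (x 2)) = s.U (x 1) (x 2) * s.angularSpeed x := by
  have hU := hx.U_pos
  have hR := hx.angularSpeed_pos
  rw [hx.angularDelta_eq, show s.U (x 1) (x 2) * (s.angularSpeed x ^ 2 * s.U (x 1) (x 2))
      = (s.U (x 1) (x 2) * s.angularSpeed x) ^ 2 by ring, Real.sqrt_sq (by positivity)]

/-- With `U` in this form, the coframe `formB`, `formC` is evaluated on the frame by polynomial
identities in `sin θ`. -/
theorem U_eq_sub (s : KNdS) (r θ : ℝ) :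
    s.U r θ = r ^ 2 + s.a ^ 2 - s.a ^ 2 * Real.sin θ ^ 2 := by
  rw [U, Real.sin_sq]; ring

theorem metric_add_left (s : KNdS) (x v v' w : Fin 4 → ℝ) :
    s.metric x (v + v') w = s.metric x v w + s.metric x v' w := by
  simp [metric, formB, formC]; ring

theorem metric_smul_left (s : KNdS) (x v w : Fin 4 → ℝ) (c : ℝ) :
    s.metric x (c • v) w = c * s.metric x v w := by
  simp [metric, formB, formC]; ring

theorem metric_neg_left (s : KNdS) (x v w : Fin 4 → ℝ) :
    s.metric x (-v) w = -s.metric x v w := by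
  simpa using s.metric_smul_left x v w (-1)

theorem IsRegular.formB_frame (hx : s.IsRegular x) (α : Fin 4) :
    s.formB x (s.frame α x) = ![(s.radialSpeed x)⁻¹, 0, 0, 0] α := by
  have hU := hx.U_pos
  have hR := hx.radialSpeed_pos
  have hT := hx.angularSpeed_pos
  have hE := s.E_pos
  have hs := hx.sin_pos
  have hUs := s.U_eq_sub (x 1) (x 2)
  fin_cases α
  · simp [hx.frame_zero, formB]; field_simp; rw [hUs]
  · simp [frame_one, formB]
  · simp [frame_two, formB]
  · simp [hx.frame_three, formB]; field_simp; ring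

theorem IsRegular.formC_frame (hx : s.IsRegular x) (α : Fin 4) :
    s.formC x (s.frame α x) = ![0, 0, 0, (Real.sin (x 2) * s.angularSpeed x)⁻¹] α := by
  have hU := hx.U_pos
  have hR := hx.radialSpeed_pos
  have hT := hx.angularSpeed_pos
  have hE := s.E_pos
  have hs := hx.sin_pos
  have hUs := s.U_eq_sub (x 1) (x 2)
  fin_cases α
  · simp [hx.frame_zero, formC]; field_simp; ring
  · simp [frame_one, formC]
  · simp [frame_two, formC]
  · simp [hx.frame_three, formC]; field_simp; rw [hUs]; ring

/-- The frame is orthonormal. -/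
theorem IsRegular.metric_frame (hx : s.IsRegular x) (α β : Fin 4) :
    s.metric x (s.frame α x) (s.frame β x) = Matrix.diagonal ![-1, 1, 1, 1] α β := by
  have hU := hx.U_pos
  have hR := hx.radialSpeed_pos
  have hT := hx.angularSpeed_pos
  have hs := hx.sin_pos
  unfold metric
  rw [hx.radialDelta_eq, hx.angularDelta_eq, hx.formB_frame, hx.formB_frame, hx.formC_frame,
    hx.formC_frame]
  fin_cases α <;> fin_cases β <;>
    simp [hx.frame_zero, frame_one, frame_two, hx.frame_three] <;> field_simp

/-- The derivative terms of the Koszul formula vanish in an orthonormal frame. -/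
theorem fderiv_metric_frame (hx : s.IsRegular x) (α β : Fin 4) :
    fderiv ℝ (fun y => s.metric y (s.frame α y) (s.frame β y)) x = 0 := by
  have h : (fun y => s.metric y (s.frame α y) (s.frame β y))
      =ᶠ[𝓝 x] fun _ => Matrix.diagonal ![-1, 1, 1, 1] α β := by
    filter_upwards [hx.eventually] with y hy using hy.metric_frame α β
  rw [h.fderiv_eq]
  simp

/-- The function `∂_r log √Δ₊(r) - r / U`, which up to the factor `√(Δ₊(r) / U)` is the acceleration
of the observers `e₀` in the direction `e₁`. -/
def accel (s : KNdS) (x : Fin 4 → ℝ) : ℝ :=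
  s.radialDeltaDeriv (x 1) / (2 * s.radialDelta (x 1)) - x 1 / s.U (x 1) (x 2)

/-- The function `∂_θ log √U`. -/
def angularLogU (s : KNdS) (x : Fin 4 → ℝ) : ℝ :=
  -(s.a ^ 2 * Real.cos (x 2) * Real.sin (x 2)) / s.U (x 1) (x 2)

/-- The `e₃`-component of `[e₂, e₃]`, up to the factor `√(Δ₊(θ) / U)`. -/
def angularDivergence (s : KNdS) (x : Fin 4 → ℝ) : ℝ :=
  s.kappa ^ 2 * s.a ^ 2 * Real.cos (x 2) * Real.sin (x 2) / s.angularDelta (x 2)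
    - Real.cos (x 2) / Real.sin (x 2)
    - s.a ^ 2 * Real.cos (x 2) * Real.sin (x 2) / s.U (x 1) (x 2)

/-- Together with the five lemmas that follow, this expresses all commutators of the frame in the
frame itself. -/
theorem IsRegular.lieBracket_one_zero (hx : s.IsRegular x) :
    VectorField.lieBracket ℝ (s.frame 1) (s.frame 0) x =
      -(s.radialSpeed x * s.accel x) • s.frame 0 x
        + (2 * x 1 * s.a * Real.sin (x 2) * s.angularSpeed x / s.U (x 1) (x 2)) • s.frame 3 x := by
  obtain ⟨D0, h0, e0⟩ := hx.hasFDerivAt_frame_zero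
  obtain ⟨D1, h1, e1⟩ := hx.hasFDerivAt_frame_one
  have hU := hx.U_pos
  have hD := hx.radialDelta_pos
  have hR := hx.radialSpeed_pos
  have hT := hx.angularSpeed_pos
  have hs := hx.sin_pos
  have hUs := s.U_eq_sub (x 1) (x 2)
  rw [VectorField.lieBracket_eq]
  dsimp only
  rw [h0.fderiv, h1.fderiv, e0, e1, hx.sqrt_U_mul_radialDelta]
  ext i
  fin_cases i <;> simp [hx.frame_zero, frame_one, hx.frame_three, dU, accel] <;> field_simp
  · rw [hUs]; ring
  · ring

theorem IsRegular.lieBracket_two_zero (hx : s.IsRegular x) :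
    VectorField.lieBracket ℝ (s.frame 2) (s.frame 0) x =
      -(s.angularSpeed x * s.angularLogU x) • s.frame 0 x := by
  obtain ⟨D0, h0, e0⟩ := hx.hasFDerivAt_frame_zero
  obtain ⟨D1, h1, e1⟩ := hx.hasFDerivAt_frame_two
  have hU := hx.U_pos
  have hR := hx.radialSpeed_pos
  rw [VectorField.lieBracket_eq]
  dsimp only
  rw [h0.fderiv, h1.fderiv, e0, e1]
  ext i
  fin_cases i <;> simp [hx.frame_zero, frame_two, dU, dAngularDelta, angularLogU] <;> field_simp <;> simp

theorem IsRegular.lieBracket_three_zero (hx : s.IsRegular x) :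
    VectorField.lieBracket ℝ (s.frame 3) (s.frame 0) x = 0 := by
  obtain ⟨D0, h0, e0⟩ := hx.hasFDerivAt_frame_zero
  obtain ⟨D1, h1, e1⟩ := hx.hasFDerivAt_frame_three
  rw [VectorField.lieBracket_eq]
  dsimp only
  rw [h0.fderiv, h1.fderiv, e0, e1]
  ext i
  fin_cases i <;> simp [hx.frame_zero, hx.frame_three, dU, dAngularDelta]

theorem IsRegular.lieBracket_one_two (hx : s.IsRegular x) :
    VectorField.lieBracket ℝ (s.frame 1) (s.frame 2) x =
      (s.angularSpeed x * s.angularLogU x) • s.frame 1 x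
        + -(s.radialSpeed x * (x 1 / s.U (x 1) (x 2))) • s.frame 2 x := by
  obtain ⟨D0, h0, e0⟩ := hx.hasFDerivAt_frame_one
  obtain ⟨D1, h1, e1⟩ := hx.hasFDerivAt_frame_two
  have hU := hx.U_pos
  rw [VectorField.lieBracket_eq]
  dsimp only
  rw [h0.fderiv, h1.fderiv, e0, e1]
  ext i
  fin_cases i <;> simp [frame_one, frame_two, dU, dAngularDelta, angularLogU] <;> field_simp <;> simp

theorem IsRegular.lieBracket_one_three (hx : s.IsRegular x) :
    VectorField.lieBracket ℝ (s.frame 1) (s.frame 3) x =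
      -(s.radialSpeed x * (x 1 / s.U (x 1) (x 2))) • s.frame 3 x := by
  obtain ⟨D0, h0, e0⟩ := hx.hasFDerivAt_frame_one
  obtain ⟨D1, h1, e1⟩ := hx.hasFDerivAt_frame_three
  have hU := hx.U_pos
  rw [VectorField.lieBracket_eq]
  dsimp only
  rw [h0.fderiv, h1.fderiv, e0, e1]
  ext i
  fin_cases i <;> simp [frame_one, hx.frame_three, dU, dAngularDelta] <;> field_simp <;> simp

theorem IsRegular.lieBracket_two_three (hx : s.IsRegular x) :
    VectorField.lieBracket ℝ (s.frame 2) (s.frame 3) x =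
      -(2 * s.a * Real.cos (x 2) * s.radialSpeed x / s.U (x 1) (x 2)) • s.frame 0 x
        + (s.angularSpeed x * s.angularDivergence x) • s.frame 3 x := by
  obtain ⟨D0, h0, e0⟩ := hx.hasFDerivAt_frame_two
  obtain ⟨D1, h1, e1⟩ := hx.hasFDerivAt_frame_three
  have hU := hx.U_pos
  have hD := s.angularDelta_pos (x 2)
  have hR := hx.radialSpeed_pos
  have hT := hx.angularSpeed_pos
  have hs := hx.sin_pos
  have hUs := s.U_eq_sub (x 1) (x 2)
  rw [VectorField.lieBracket_eq]
  dsimp only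
  rw [h0.fderiv, h1.fderiv, e0, e1, hx.sqrt_U_mul_angularDelta]
  ext i
  fin_cases i <;>
    simp [hx.frame_zero, frame_two, hx.frame_three, dU, dAngularDelta, angularDivergence] <;>
    field_simp
  · rw [hUs]; ring
  · rw [hUs]; ring

end KNdS

namespace KNdS

/-! ### The connection coefficients and the Dirac operator in the frame -/

/-- The connection coefficients `ω_{αβ}(e_γ)` of the frame, in the order
`γ`, `α`, `β`. -/
def connectionTable (s : KNdS) (x : Fin 4 → ℝ) : Fin 4 → Fin 4 → Fin 4 → ℝ :=
  let A := s.radialSpeed x * s.accel x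
  let L := s.angularSpeed x * s.angularLogU x
  let H := s.radialSpeed x * (x 1 / s.U (x 1) (x 2))
  let D := s.angularSpeed x * s.angularDivergence x
  let K := x 1 * s.a * Real.sin (x 2) * s.angularSpeed x / s.U (x 1) (x 2)
  let M := s.a * Real.cos (x 2) * s.radialSpeed x / s.U (x 1) (x 2)
  ![![![0, -A, -L, 0], ![A, 0, 0, K], ![L, 0, 0, M], ![0, -K, -M, 0]],
    ![![0, 0, 0, -K], ![0, 0, L, 0], ![0, -L, 0, 0], ![K, 0, 0, 0]],
    ![![0, 0, 0, M], ![0, 0, -H, 0], ![0, H, 0, 0], ![-M, 0, 0, 0]],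
    ![![0, -K, -M, 0], ![K, 0, 0, -H], ![M, 0, 0, D], ![0, H, -D, 0]]]

variable {s : KNdS} {x : Fin 4 → ℝ}

/-- The Koszul formula, evaluated with the commutators of the frame. -/
theorem IsRegular.connection_eq (hx : s.IsRegular x) (α β γ : Fin 4) :
    s.connection α β γ x = s.connectionTable x γ α β := by
  have e10 := hx.lieBracket_one_zero
  have e20 := hx.lieBracket_two_zero
  have e30 := hx.lieBracket_three_zero
  have e12 := hx.lieBracket_one_two
  have e13 := hx.lieBracket_one_three
  have e23 := hx.lieBracket_two_three
  have e01 := VectorField.lieBracket_swap (𝕜 := ℝ) (V := s.frame 0) (W := s.frame 1) (x := x)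
  have e02 := VectorField.lieBracket_swap (𝕜 := ℝ) (V := s.frame 0) (W := s.frame 2) (x := x)
  have e03 := VectorField.lieBracket_swap (𝕜 := ℝ) (V := s.frame 0) (W := s.frame 3) (x := x)
  have e21 := VectorField.lieBracket_swap (𝕜 := ℝ) (V := s.frame 2) (W := s.frame 1) (x := x)
  have e31 := VectorField.lieBracket_swap (𝕜 := ℝ) (V := s.frame 3) (W := s.frame 1) (x := x)
  have e32 := VectorField.lieBracket_swap (𝕜 := ℝ) (V := s.frame 3) (W := s.frame 2) (x := x)
  rw [e10] at e01
  rw [e20] at e02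
  rw [e30] at e03
  rw [e12] at e21
  rw [e13] at e31
  rw [e23] at e32
  have m := hx.metric_frame
  have z (w : Fin 4 → ℝ) : s.metric x 0 w = 0 := by simp [metric, formB, formC]
  simp only [connection, leviCivita, fderiv_metric_frame hx, connectionTable]
  fin_cases α <;> fin_cases β <;> fin_cases γ <;>
    simp [e10, e20, e30, e12, e13, e23, e01, e02, e03, e21, e31, e32, metric_add_left,
      metric_smul_left, metric_neg_left, m, z, VectorField.lieBracket_self] <;> ring

theorem cliffordMatrix_mulVec (α : Fin 4) (v : Fin 4 → ℂ) :
    (cliffordMatrix α).mulVec v =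
      ![![-v 2, -v 3, -v 0, -v 1], ![-v 2, v 3, v 0, -v 1], ![v 3, v 2, -v 1, -v 0],
        ![Complex.I * v 3, -(Complex.I * v 2), -(Complex.I * v 1), Complex.I * v 0]] α := by
  ext i
  fin_cases α <;> fin_cases i <;>
    simp [cliffordMatrix, Matrix.mulVec, dotProduct, Fin.sum_univ_four]

theorem sum_sum_Ioi_fin_four {M : Type*} [AddCommMonoid M] (f : Fin 4 → Fin 4 → M) :
    ∑ α : Fin 4, ∑ β ∈ Finset.Ioi α, f α β =
      f 0 1 + f 0 2 + f 0 3 + f 1 2 + f 1 3 + f 2 3 := by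
  rw [Fin.sum_univ_four, show Finset.Ioi (0 : Fin 4) = {1, 2, 3} by decide,
    show Finset.Ioi (1 : Fin 4) = {2, 3} by decide, show Finset.Ioi (2 : Fin 4) = {3} by decide,
    show Finset.Ioi (3 : Fin 4) = ∅ by decide]
  simp [add_assoc]

/-- The spinorial derivative with the six products `e^α e^β`, `α < β`, written out. -/
theorem IsRegular.spinDeriv_eq (hx : s.IsRegular x) (γ : Fin 4)
    (ψ : (Fin 4 → ℝ) → (Fin 4 → ℂ)) :
    s.spinDeriv γ ψ x = fderiv ℝ ψ x (s.frame γ x) - (1 / 2 : ℂ) •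
      ((s.connectionTable x γ 0 1 : ℂ) • ![-ψ x 0, ψ x 1, ψ x 2, -ψ x 3]
      + (s.connectionTable x γ 0 2 : ℂ) • ![ψ x 1, ψ x 0, -ψ x 3, -ψ x 2]
      + (s.connectionTable x γ 0 3 : ℂ) • Complex.I • ![ψ x 1, -ψ x 0, -ψ x 3, ψ x 2]
      + (s.connectionTable x γ 1 2 : ℂ) • ![ψ x 1, -ψ x 0, ψ x 3, -ψ x 2]
      + (s.connectionTable x γ 1 3 : ℂ) • Complex.I • ![ψ x 1, ψ x 0, ψ x 3, ψ x 2]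
      + (s.connectionTable x γ 2 3 : ℂ) • Complex.I • ![ψ x 0, -ψ x 1, ψ x 2, -ψ x 3]) := by
  rw [spinDeriv, sum_sum_Ioi_fin_four]
  simp only [hx.connection_eq, ← Matrix.mulVec_mulVec, cliffordMatrix_mulVec]
  congr 2
  ext i
  fin_cases i <;> simp

/-- The zeroth-order coefficient of the radial part of the Dirac operator, without the factor
`√(Δ₊(r) / U)`. -/
def radialCoeff (s : KNdS) (x : Fin 4 → ℝ) : ℝ :=
  s.radialDeltaDeriv (x 1) / (4 * s.radialDelta (x 1)) + x 1 / (2 * s.U (x 1) (x 2))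

/-- The zeroth-order coefficient of the angular part of the Dirac operator, without the factor
`√(Δ₊(θ) / U)`. -/
def angularCoeff (s : KNdS) (x : Fin 4 → ℝ) : ℝ :=
  s.angularLogU x - s.angularDivergence x / 2

/-- Row `j` of the Dirac operator: it involves only the components `j + 2` (radially) and `3 - j`
(in the angular directions). -/
theorem IsRegular.diracOp_apply (hx : s.IsRegular x) (ψ : (Fin 4 → ℝ) → (Fin 4 → ℂ))
    (j : Fin 4) :
    s.diracOp ψ x j =
      -(fderiv ℝ ψ x (s.frame 0 x) (j + 2))
      + ![-1, 1, 1, -1] j * (fderiv ℝ ψ x (s.frame 1 x) (j + 2)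
        + (s.radialSpeed x * s.radialCoeff x : ℝ) * ψ x (j + 2))
      + Complex.I * ![-1, 1, -1, 1] j
        * (s.a * Real.cos (x 2) * s.radialSpeed x / (2 * s.U (x 1) (x 2)) : ℝ) * ψ x (j + 2)
      + ![1, 1, -1, -1] j * (fderiv ℝ ψ x (s.frame 2 x) j.rev
        + (s.angularSpeed x * s.angularCoeff x : ℝ) * ψ x j.rev)
      + Complex.I * ![1, -1, -1, 1] j * fderiv ℝ ψ x (s.frame 3 x) j.rev
      + Complex.I * (x 1 * s.a * Real.sin (x 2) * s.angularSpeed x / (2 * s.U (x 1) (x 2)) : ℝ)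
        * ψ x j.rev := by
  -- The trace of the connection in the direction `e₁`.
  have hR : (s.radialSpeed x * s.radialCoeff x : ℝ) =
      (s.radialSpeed x * s.accel x + 2 * (s.radialSpeed x * (x 1 / s.U (x 1) (x 2)))) / 2 := by
    have := hx.U_pos
    have := hx.radialDelta_pos
    rw [radialCoeff, accel]
    field_simp
    ring
  rw [hR, angularCoeff]
  rw [diracOp, Fin.sum_univ_four]
  simp only [hx.spinDeriv_eq, connectionTable, cliffordMatrix_mulVec]
  -- Both sides are now polynomial in these quantities, up to the relation `I ^ 2 = -1`.
  generalize s.radialSpeed x = R, s.angularSpeed x = T, s.accel x = A, s.angularLogU x = L,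
    s.angularDivergence x = D, s.U (x 1) (x 2) = u, fderiv ℝ ψ x = d
  fin_cases j <;> simp [Fin.rev] <;> ring_nf <;> simp only [Complex.I_sq] <;> ring

end KNdS

namespace KNdS

/-! ### The components of a separated spinor -/

variable {s : KNdS}

/-- The complex numbers `ρ, ρ, ρ̄, ρ̄` whose square roots enter the matrix `S₊`. -/
def rho (s : KNdS) (j : Fin 4) (r θ : ℝ) : ℂ :=
  (r : ℂ) + ![1, 1, -1, -1] j * (Complex.I * s.a * Real.cos θ)

theorem rho_re (s : KNdS) (j : Fin 4) (r θ : ℝ) : (s.rho j r θ).re = r := by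
  fin_cases j <;> simp [rho, -Complex.ofReal_cos]

theorem norm_rho (s : KNdS) (j : Fin 4) (r θ : ℝ) : ‖s.rho j r θ‖ = √(s.U r θ) := by
  have h : (s.rho j r θ).im ^ 2 = s.a ^ 2 * Real.cos θ ^ 2 := by
    fin_cases j <;> simp [rho, -Complex.ofReal_cos] <;> ring
  rw [Complex.norm_def, Complex.normSq_apply, ← sq, ← sq, h, rho_re, U]

theorem rho_mem_slitPlane (s : KNdS) (j : Fin 4) {r : ℝ} (hr : 0 < r) (θ : ℝ) :
    s.rho j r θ ∈ Complex.slitPlane := Or.inl (by rwa [rho_re])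

theorem rho_ne_zero (s : KNdS) (j : Fin 4) {r : ℝ} (hr : 0 < r) (θ : ℝ) :
    s.rho j r θ ≠ 0 := Complex.slitPlane_ne_zero (s.rho_mem_slitPlane j hr θ)

/-- The factor `(Δ₊(r)^{1/4} ρ^{1/2})⁻¹` by which `S₊⁻¹` multiplies the component `j`. -/
def spinWeight (s : KNdS) (j : Fin 4) (r θ : ℝ) : ℂ :=
  ((|s.radialDelta r| ^ (1 / 4 : ℝ) : ℝ) : ℂ)⁻¹ * (s.rho j r θ ^ (1 / 2 : ℂ))⁻¹

/-- `S₊` is diagonal, and invertible where `r` and `Δ₊(r)` are positive. -/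
theorem inv_matrixS_mulVec (s : KNdS) {r θ : ℝ} (hr : 0 < r) (hD : 0 < s.radialDelta r)
    (v : Fin 4 → ℂ) (j : Fin 4) :
    (s.matrixS r θ)⁻¹.mulVec v j = s.spinWeight j r θ * v j := by
  have hc : ((|s.radialDelta r| ^ (1 / 4 : ℝ) : ℝ) : ℂ) ≠ 0 := by
    rw [Complex.ofReal_ne_zero]
    have : 0 < |s.radialDelta r| := abs_pos.2 hD.ne'
    positivity
  have hrho (i : Fin 4) : s.rho i r θ ^ (1 / 2 : ℂ) ≠ 0 := by
    rw [Ne, Complex.cpow_eq_zero_iff]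
    exact fun h => s.rho_ne_zero i hr θ h.1
  have hS : s.matrixS r θ = Matrix.diagonal fun i : Fin 4 =>
      ((|s.radialDelta r| ^ (1 / 4 : ℝ) : ℝ) : ℂ) * s.rho i r θ ^ (1 / 2 : ℂ) := by
    rw [matrixS, ← Matrix.diagonal_smul]
    congr 1
    ext i
    fin_cases i <;> simp [rho, sub_eq_add_neg]
  have hinv : (s.matrixS r θ)⁻¹ = Matrix.diagonal fun i => s.spinWeight i r θ := by
    apply Matrix.inv_eq_right_inv
    rw [hS, Matrix.diagonal_mul_diagonal, ← Matrix.diagonal_one]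
    congr 1
    ext i
    have := hrho i
    rw [spinWeight]
    field_simp
  rw [hinv, Matrix.mulVec_diagonal]

theorem norm_spinWeight_sq (s : KNdS) (j : Fin 4) {r : ℝ}
    (hD : 0 < s.radialDelta r) (θ : ℝ) :
    ‖s.spinWeight j r θ‖ ^ 2 = (√(s.radialDelta r) * √(s.U r θ))⁻¹ := by
  have h1 : ‖s.rho j r θ ^ (1 / 2 : ℂ)‖ ^ 2 = √(s.U r θ) := by
    rw [show (1 / 2 : ℂ) = ((1 / 2 : ℝ) : ℂ) by norm_num,
      Complex.norm_cpow_real, norm_rho, ← Real.rpow_natCast, ← Real.rpow_mul (by positivity)]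
    norm_num
  have h2 : (|s.radialDelta r| ^ (1 / 4 : ℝ)) ^ 2 = √(s.radialDelta r) := by
    rw [abs_of_pos hD, ← Real.rpow_natCast, ← Real.rpow_mul hD.le, Real.sqrt_eq_rpow]
    norm_num
  rw [spinWeight, norm_mul, norm_inv, norm_inv, mul_pow, inv_pow, inv_pow, h1, Complex.norm_real,
    Real.norm_eq_abs, sq_abs, h2, mul_inv]

theorem norm_spinWeight_congr (s : KNdS) (i j : Fin 4) {r : ℝ}
    (hD : 0 < s.radialDelta r) (θ : ℝ) : ‖s.spinWeight i r θ‖ = ‖s.spinWeight j r θ‖ := by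
  rw [← sq_eq_sq₀ (norm_nonneg _) (norm_nonneg _), s.norm_spinWeight_sq i hD,
    s.norm_spinWeight_sq j hD]

theorem spinWeight_ne_zero (s : KNdS) (j : Fin 4) {r : ℝ} (hr : 0 < r)
    (hD : 0 < s.radialDelta r) (θ : ℝ) : s.spinWeight j r θ ≠ 0 := by
  have := s.norm_spinWeight_sq j hD θ
  have hU := s.U_pos hr θ
  intro h
  rw [h, norm_zero] at this
  have h' : 0 < (√(s.radialDelta r) * √(s.U r θ))⁻¹ := by positivity
  rw [← this] at h'
  norm_num at h'

/-- The logarithmic `θ`-derivative of the spin weights is bounded uniformly in the radius. -/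
theorem exists_hasDerivAt_spinWeight (s : KNdS) (j : Fin 4) {r : ℝ} (hr : 0 < r)
    (θ : ℝ) :
    ∃ q : ℂ, HasDerivAt (fun θ => s.spinWeight j r θ) (q * s.spinWeight j r θ) θ ∧
      ‖q‖ ≤ |s.a| / (2 * r) := by
  have h1 : HasDerivAt (fun θ => s.rho j r θ)
      (![1, 1, -1, -1] j * (Complex.I * s.a * -Real.sin θ)) θ := by
    have := (((Real.hasDerivAt_cos θ).ofReal_comp.const_mul (Complex.I * s.a)).const_mul
      ((![1, 1, -1, -1] : Fin 4 → ℂ) j)).const_add (r : ℂ)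
    simpa [rho] using this
  have h2 : HasDerivAt (fun θ => s.rho j r θ ^ (1 / 2 : ℂ)) _ θ :=
    (Complex.hasStrictDerivAt_cpow_const (s.rho_mem_slitPlane j hr θ)).hasDerivAt.comp θ h1
  have hne : s.rho j r θ ^ (1 / 2 : ℂ) ≠ 0 := by
    rw [Ne, Complex.cpow_eq_zero_iff]
    exact fun h => s.rho_ne_zero j hr θ h.1
  have h3 := (h2.fun_inv hne).const_mul ((|s.radialDelta r| ^ (1 / 4 : ℝ) : ℝ) : ℂ)⁻¹
  refine ⟨-(1 / 2) * (![1, 1, -1, -1] j * (Complex.I * s.a * -Real.sin θ)) / s.rho j r θ,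
    h3.congr_deriv ?_, ?_⟩
  · have h0 := s.rho_ne_zero j hr θ
    rw [Complex.cpow_sub _ _ h0, Complex.cpow_one, spinWeight]
    field_simp
  · have hn : ‖(![1, 1, -1, -1] : Fin 4 → ℂ) j‖ = 1 := by fin_cases j <;> simp
    have hrr : r ≤ ‖s.rho j r θ‖ := by
      have := Complex.re_le_norm (s.rho j r θ)
      rwa [rho_re] at this
    rw [norm_div, norm_mul, norm_mul, norm_mul, norm_mul, hn, norm_neg, norm_neg, Complex.norm_I,
      Complex.norm_real, Complex.norm_real, Real.norm_eq_abs, Real.norm_eq_abs]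
    have hs := Real.abs_sin_le_one θ
    rw [div_le_div_iff₀ (hr.trans_le hrr) (by positivity)]
    have h5 : |s.a| * |Real.sin θ| * r ≤ |s.a| * 1 * ‖s.rho j r θ‖ := by gcongr
    norm_num
    linarith

/-- The radial factors of the components of a separated spinor. -/
def radialFactor (Xp Xm : ℝ → ℂ) : Fin 4 → ℝ → ℂ := ![Xm, Xp, Xp, Xm]

/-- The angular factors of the components of a separated spinor. -/
def angularFactor (Yp Ym : ℝ → ℂ) : Fin 4 → ℝ → ℂ := ![Ym, Yp, Ym, Yp]

/-- The components coupled by the angular part of the Dirac operator share the radial factor. -/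
theorem radialFactor_rev (Xp Xm : ℝ → ℂ) (j : Fin 4) :
    radialFactor Xp Xm j.rev = radialFactor Xp Xm j := by
  fin_cases j <;> rfl

/-- The components coupled by the radial part of the Dirac operator share the angular factor. -/
theorem angularFactor_add_two (Yp Ym : ℝ → ℂ) (j : Fin 4) :
    angularFactor Yp Ym (j + 2) = angularFactor Yp Ym j := by
  fin_cases j <;> rfl

/-- The phase `e^{-i(ωt + (k + 1/2)φ)}`. -/
def phase (ω : ℝ) (k : ℤ) (x : Fin 4 → ℝ) : ℂ :=
  Complex.exp (-Complex.I * ((ω : ℂ) * (x 0 : ℂ) + ((k : ℂ) + 1 / 2) * (x 3 : ℂ)))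

theorem norm_phase (ω : ℝ) (k : ℤ) (x : Fin 4 → ℝ) : ‖phase ω k x‖ = 1 := by
  rw [phase, show -Complex.I * ((ω : ℂ) * (x 0 : ℂ) + ((k : ℂ) + 1 / 2) * (x 3 : ℂ))
    = ((-(ω * x 0 + (k + 1 / 2) * x 3) : ℝ) : ℂ) * Complex.I by push_cast; ring,
    Complex.norm_exp_ofReal_mul_I]

variable {rc rm rp ω : ℝ} {k : ℤ} {Xp Xm Yp Ym : ℝ → ℂ}
  {ψ : (Fin 4 → ℝ) → (Fin 4 → ℂ)}

theorem IsSeparated.apply (hsep : s.IsSeparated rm rp ω k Xp Xm Yp Ym ψ)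
    (hs : s.IsNonExtreme rc rm rp) {x : Fin 4 → ℝ} (hx : x ∈ exterior rm rp) (j : Fin 4) :
    ψ x j = s.spinWeight j (x 1) (x 2) * (phase ω k x * (radialFactor Xp Xm j (x 1)
      * angularFactor Yp Ym j (x 2))) := by
  have hr := hs.isRegular hx
  rw [hsep x hx, inv_matrixS_mulVec s hr.r_pos hr.radialDelta_pos]
  congr 1
  fin_cases j <;> simp [separatedPhi, phase, radialFactor, angularFactor]

theorem IsSeparated.norm_apply_sq (hsep : s.IsSeparated rm rp ω k Xp Xm Yp Ym ψ)
    (hs : s.IsNonExtreme rc rm rp) {x : Fin 4 → ℝ} (hx : x ∈ exterior rm rp) (j : Fin 4) :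
    ‖ψ x j‖ ^ 2 = ‖radialFactor Xp Xm j (x 1)‖ ^ 2 * ‖angularFactor Yp Ym j (x 2)‖ ^ 2
      / (√(s.radialDelta (x 1)) * √(s.U (x 1) (x 2))) := by
  have hr := hs.isRegular hx
  rw [hsep.apply hs hx, norm_mul, norm_mul, norm_mul, norm_phase, mul_pow, one_mul, mul_pow,
    norm_spinWeight_sq s j hr.radialDelta_pos]
  ring

/-- Time translations and rotations about the axis act on a separated spinor by phases. -/
theorem IsSeparated.fderiv_killing (hsep : s.IsSeparated rm rp ω k Xp Xm Yp Ym ψ)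
    (hs : s.IsNonExtreme rc rm rp) {x : Fin 4 → ℝ} (hx : x ∈ exterior rm rp)
    (hd : DifferentiableAt ℝ ψ x) {v : Fin 4 → ℝ} (h1 : v 1 = 0) (h2 : v 2 = 0) (j : Fin 4) :
    fderiv ℝ ψ x v j = -(Complex.I * (ω * v 0 + (k + 1 / 2) * v 3 : ℝ)) * ψ x j := by
  have hline : HasDerivAt (fun τ : ℝ => x + τ • v) v 0 := by
    simpa using ((hasDerivAt_id (0 : ℝ)).smul_const v).const_add x
  have hd' : HasFDerivAt ψ (fderiv ℝ ψ x) (x + (0 : ℝ) • v) := by simpa using hd.hasFDerivAt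
  have e1 := hasDerivAt_pi.1 (hd'.comp_hasDerivAt 0 hline) j
  -- Along the line `x + τ v`, which stays in the exterior region, `ψ` only picks up a phase.
  have e2 : HasDerivAt
      (fun τ : ℝ => Complex.exp ((τ : ℂ) * -(Complex.I * (ω * v 0 + (k + 1 / 2) * v 3 : ℝ)))
        * ψ x j) (-(Complex.I * (ω * v 0 + (k + 1 / 2) * v 3 : ℝ)) * ψ x j) 0 := by
    have := (((hasDerivAt_id (0 : ℝ)).ofReal_comp.mul_const
      (-(Complex.I * (ω * v 0 + (k + 1 / 2) * v 3 : ℝ)))).cexp).mul_const (ψ x j)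
    simpa using this
  refine e1.unique (e2.congr_of_eventuallyEq (Eventually.of_forall fun τ => ?_))
  have hy : x + τ • v ∈ exterior rm rp := by simpa [exterior, h1, h2] using hx
  simp only [Function.comp]
  rw [hsep.apply hs hy, hsep.apply hs hx]
  have hp : phase ω k (x + τ • v) =
      Complex.exp ((τ : ℂ) * -(Complex.I * (ω * v 0 + (k + 1 / 2) * v 3 : ℝ)))
        * phase ω k x := by
    rw [phase, phase, ← Complex.exp_add]
    congr 1
    simp
    ring
  simp only [hp, Pi.add_apply, Pi.smul_apply, h1, h2, smul_zero, add_zero]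
  ring

theorem hasDerivAt_radial {t r θ φ : ℝ} (hd : DifferentiableAt ℝ ψ (slicePoint t (r, θ, φ)))
    (j : Fin 4) : HasDerivAt (fun r => ψ (slicePoint t (r, θ, φ)) j)
      (fderiv ℝ ψ (slicePoint t (r, θ, φ)) ![0, 1, 0, 0] j) r := by
  have h : HasDerivAt (fun r => slicePoint t (r, θ, φ)) ![0, 1, 0, 0] r := by
    rw [hasDerivAt_pi]
    intro i
    fin_cases i
    · exact hasDerivAt_const _ _
    · exact hasDerivAt_id _
    · exact hasDerivAt_const _ _
    · exact hasDerivAt_const _ _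
  exact hasDerivAt_pi.1 (hd.hasFDerivAt.comp_hasDerivAt r h) j

theorem hasDerivAt_angular {t r θ φ : ℝ} (hd : DifferentiableAt ℝ ψ (slicePoint t (r, θ, φ)))
    (j : Fin 4) : HasDerivAt (fun θ => ψ (slicePoint t (r, θ, φ)) j)
      (fderiv ℝ ψ (slicePoint t (r, θ, φ)) ![0, 0, 1, 0] j) θ := by
  have h : HasDerivAt (fun θ => slicePoint t (r, θ, φ)) ![0, 0, 1, 0] θ := by
    rw [hasDerivAt_pi]
    intro i
    fin_cases i
    · exact hasDerivAt_const _ _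
    · exact hasDerivAt_const _ _
    · exact hasDerivAt_id _
    · exact hasDerivAt_const _ _
  exact hasDerivAt_pi.1 (hd.hasFDerivAt.comp_hasDerivAt θ h) j

theorem slicePoint_mem_exterior {t r θ φ : ℝ} (hr : r ∈ Set.Ioo rm rp)
    (hθ : θ ∈ Set.Ioo 0 Real.pi) : slicePoint t (r, θ, φ) ∈ exterior rm rp :=
  ⟨hr.1, hr.2, hθ.1, hθ.2⟩

/-- Where its radial factor does not vanish, differentiability of a component of a separated spinor
implies differentiability of the angular factor. -/
theorem IsSeparated.differentiableAt_angularFactor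
    (hsep : s.IsSeparated rm rp ω k Xp Xm Yp Ym ψ) (hs : s.IsNonExtreme rc rm rp)
    {t r θ φ : ℝ} (hr : r ∈ Set.Ioo rm rp) (hθ : θ ∈ Set.Ioo 0 Real.pi) {j : Fin 4}
    (hd : DifferentiableAt ℝ ψ (slicePoint t (r, θ, φ))) (hX : radialFactor Xp Xm j r ≠ 0) :
    DifferentiableAt ℝ (angularFactor Yp Ym j) θ := by
  have hr0 : 0 < r := (hs.rc_pos.trans hs.rc_lt_rm).trans hr.1
  have hD := hs.radialDelta_pos hr.1 hr.2
  obtain ⟨q, hq, -⟩ := s.exists_hasDerivAt_spinWeight j hr0 θ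
  set c : ℂ := phase ω k (slicePoint t (r, θ, φ)) * radialFactor Xp Xm j r with hc
  have hc0 : c ≠ 0 := mul_ne_zero (norm_ne_zero_iff.1 (by rw [norm_phase]; norm_num)) hX
  have h := ((hasDerivAt_angular hd j).differentiableAt.mul
    (hq.differentiableAt.inv (s.spinWeight_ne_zero j hr0 hD θ))).const_mul c⁻¹
  refine h.congr_of_eventuallyEq ?_
  filter_upwards [isOpen_Ioo.mem_nhds hθ] with y hy
  have := s.spinWeight_ne_zero j hr0 hD y
  have e := hsep.apply hs (slicePoint_mem_exterior (t := t) (φ := φ) hr hy) j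
  have hc' : phase ω k (slicePoint t (r, y, φ)) * radialFactor Xp Xm j r = c := rfl
  simp only [Pi.mul_apply, Pi.inv_apply]
  rw [e, ← mul_assoc (phase ω k _),
    show slicePoint t (r, y, φ) 1 = r from rfl, show slicePoint t (r, y, φ) 2 = y from rfl, hc']
  field_simp

/-- On a meridian `θ = const` on which the component `j` of a separated spinor has a non-vanishing
angular factor, it dominates the component `3 - j`, which has the same radial factor, together with
its `θ`-derivative. -/
theorem IsSeparated.exists_norm_rev_le (hsep : s.IsSeparated rm rp ω k Xp Xm Yp Ym ψ)
    (hs : s.IsNonExtreme rc rm rp) (hd : ∀ x ∈ exterior rm rp, DifferentiableAt ℝ ψ x)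
    {t θ φ : ℝ} (hθ : θ ∈ Set.Ioo 0 Real.pi) {j : Fin 4} (hY : angularFactor Yp Ym j θ ≠ 0) :
    ∃ C, 0 ≤ C ∧ ∀ r ∈ Set.Ioo rm rp,
      ‖ψ (slicePoint t (r, θ, φ)) j.rev‖ ≤ C * ‖ψ (slicePoint t (r, θ, φ)) j‖ ∧
      ‖fderiv ℝ ψ (slicePoint t (r, θ, φ)) ![0, 0, 1, 0] j.rev‖
        ≤ C * ‖ψ (slicePoint t (r, θ, φ)) j‖ := by
  have hrm : 0 < rm := hs.rc_pos.trans hs.rc_lt_rm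
  set Y := angularFactor Yp Ym j θ with hYdef
  set Z := angularFactor Yp Ym j.rev with hZdef
  have hYn : 0 < ‖Y‖ := norm_pos_iff.2 hY
  have key (r : ℝ) (hr : r ∈ Set.Ioo rm rp) : ‖ψ (slicePoint t (r, θ, φ)) j.rev‖
      = ‖Z θ‖ / ‖Y‖ * ‖ψ (slicePoint t (r, θ, φ)) j‖ ∧
      ‖s.spinWeight j.rev r θ‖ * ‖radialFactor Xp Xm j r‖
        = ‖ψ (slicePoint t (r, θ, φ)) j‖ / ‖Y‖ := by
    have hr0 : 0 < r := hrm.trans hr.1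
    have hD := hs.radialDelta_pos hr.1 hr.2
    have hx := slicePoint_mem_exterior (t := t) (φ := φ) hr hθ
    rw [hsep.apply hs hx, hsep.apply hs hx, radialFactor_rev]
    simp only [norm_mul, norm_phase, one_mul]
    rw [show slicePoint t (r, θ, φ) 1 = r from rfl, show slicePoint t (r, θ, φ) 2 = θ from rfl,
      ← hYdef, ← hZdef, s.norm_spinWeight_congr j.rev j hD]
    constructor <;> field_simp
  refine ⟨‖Z θ‖ / ‖Y‖ + (|s.a| / (2 * rm) * ‖Z θ‖ + ‖deriv Z θ‖) / ‖Y‖, by positivity,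
    fun r hr => ⟨?_, ?_⟩⟩
  · rw [(key r hr).1, add_mul]
    exact le_add_of_nonneg_right (by positivity)
  have hr0 : 0 < r := hrm.trans hr.1
  have hD := hs.radialDelta_pos hr.1 hr.2
  have hx := slicePoint_mem_exterior (t := t) (φ := φ) hr hθ
  have hder := hasDerivAt_angular (hd _ hx) j.rev
  set c : ℂ := phase ω k (slicePoint t (r, θ, φ)) * radialFactor Xp Xm j r with hc
  have heq : (fun θ => ψ (slicePoint t (r, θ, φ)) j.rev) =ᶠ[𝓝 θ]
      fun θ => c * (s.spinWeight j.rev r θ * Z θ) := by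
    filter_upwards [isOpen_Ioo.mem_nhds hθ] with y hy
    rw [hsep.apply hs (slicePoint_mem_exterior (t := t) (φ := φ) hr hy), radialFactor_rev]
    have hc' : phase ω k (slicePoint t (r, y, φ)) * radialFactor Xp Xm j r = c := rfl
    rw [← hc']
    simp only [slicePoint, hZdef]
    simp
    ring
  -- Nothing is assumed about `Z`: its differentiability at `θ` follows from that of `ψ` only where
  -- the radial factor does not vanish.
  by_cases hX : radialFactor Xp Xm j r = 0
  · have h0 : fderiv ℝ ψ (slicePoint t (r, θ, φ)) ![0, 0, 1, 0] j.rev = 0 := by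
      refine hder.unique ((hasDerivAt_const θ (0 : ℂ)).congr_of_eventuallyEq ?_)
      filter_upwards [heq] with y hy
      rw [hy, hc, hX]
      simp
    rw [h0, norm_zero]
    positivity
  · have hZd : DifferentiableAt ℝ Z θ :=
      hsep.differentiableAt_angularFactor hs hr hθ (hd _ hx) (by rwa [radialFactor_rev])
    obtain ⟨q, hq, hqn⟩ := s.exists_hasDerivAt_spinWeight j.rev hr0 θ
    have h0 := hder.unique (((hq.mul hZd.hasDerivAt).const_mul c).congr_of_eventuallyEq heq)
    have hcn : ‖c‖ = ‖radialFactor Xp Xm j r‖ := by rw [hc, norm_mul, norm_phase, one_mul]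
    have hqr : ‖q‖ ≤ |s.a| / (2 * rm) := hqn.trans (by gcongr; exact hr.1.le)
    calc ‖fderiv ℝ ψ (slicePoint t (r, θ, φ)) ![0, 0, 1, 0] j.rev‖
        = ‖s.spinWeight j.rev r θ‖ * ‖radialFactor Xp Xm j r‖ * ‖q * Z θ + deriv Z θ‖ := by
          rw [h0, ← hcn, ← norm_mul, ← norm_mul]
          congr 1
          ring
      _ ≤ ‖ψ (slicePoint t (r, θ, φ)) j‖ / ‖Y‖
          * (|s.a| / (2 * rm) * ‖Z θ‖ + ‖deriv Z θ‖) := by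
          rw [(key r hr).2]
          gcongr
          refine (norm_add_le _ _).trans ?_
          rw [norm_mul]
          gcongr
      _ ≤ _ := by
          rw [add_mul]
          have : 0 ≤ ‖Z θ‖ / ‖Y‖ * ‖ψ (slicePoint t (r, θ, φ)) j‖ := by positivity
          refine le_trans (le_of_eq ?_) (le_add_of_nonneg_left this)
          ring

end KNdS

/-! ### A lower bound for solutions of a weakly singular linear system -/

/-- An imaginary coefficient does not change the modulus. -/
theorem inner_I_smul_self (h : ℝ) (z : ℂ) : inner ℝ z (Complex.I * h * z) = 0 := by
  rw [Complex.inner]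
  simp
  ring

theorem hasDerivAt_sqrt_sub {b r : ℝ} (hr : r < b) :
    HasDerivAt (fun r => √(b - r)) (-(1 / (2 * √(b - r)))) r := by
  have h := ((hasDerivAt_id r).const_sub b).sqrt (sub_pos.2 hr).ne'
  exact h.congr_deriv (by simp; ring)

/-- If `f` and `g` solve a linear system whose coefficients are, up to the diagonal part
`-D' / (4 D) + i h` with `h` real, bounded by the integrable function `K / √(b - r)`, then
`√D (|f|² + |g|²)` stays away from `0` as `r` approaches `b`, unless it vanishes at the starting
point. -/
theorem le_sqrt_mul_norm_sq_add_norm_sq {r₀ b K : ℝ} {D D' : ℝ → ℝ} {f f' g g' : ℝ → ℂ}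
    {h h' : ℝ → ℝ} (hK : 0 ≤ K)
    (hD : ∀ r ∈ Set.Ico r₀ b, HasDerivAt D (D' r) r) (hD0 : ∀ r ∈ Set.Ico r₀ b, 0 < D r)
    (hf : ∀ r ∈ Set.Ico r₀ b, HasDerivAt f (f' r) r)
    (hg : ∀ r ∈ Set.Ico r₀ b, HasDerivAt g (g' r) r)
    (hfb : ∀ r ∈ Set.Ico r₀ b, ‖f' r + (D' r / (4 * D r) : ℝ) * f r - Complex.I * h r * f r‖
      ≤ K / √(b - r) * (‖f r‖ + ‖g r‖))
    (hgb : ∀ r ∈ Set.Ico r₀ b, ‖g' r + (D' r / (4 * D r) : ℝ) * g r - Complex.I * h' r * g r‖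
      ≤ K / √(b - r) * (‖f r‖ + ‖g r‖)) {r : ℝ} (hr : r ∈ Set.Ico r₀ b) :
    √(D r₀) * (‖f r₀‖ ^ 2 + ‖g r₀‖ ^ 2) * Real.exp (-(8 * K * √(b - r₀)))
      ≤ √(D r) * (‖f r‖ ^ 2 + ‖g r‖ ^ 2) := by
  -- The differential inequality for one component, in which the imaginary coefficient drops out.
  have inner_le (u u' : ℝ → ℂ) (k : ℝ → ℝ) (r : ℝ) :
      -(D' r / (4 * D r)) * ‖u r‖ ^ 2
        - ‖u r‖ * ‖u' r + (D' r / (4 * D r) : ℝ) * u r - Complex.I * k r * u r‖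
        ≤ inner ℝ (u r) (u' r) := by
    set e := u' r + (D' r / (4 * D r) : ℝ) * u r - Complex.I * k r * u r with he
    have hu : u' r = e - (D' r / (4 * D r)) • u r + Complex.I * k r * u r := by
      rw [he, Complex.real_smul]; ring
    rw [hu, inner_add_right, inner_sub_right, inner_I_smul_self, real_inner_smul_right,
      real_inner_self_eq_norm_sq]
    have := abs_le.1 (abs_real_inner_le_norm (u r) e)
    linarith [this.1]
  -- The product with the integrating factor is monotone.
  -- `8 K √(b - r)` is a primitive of `-4 K / √(b - r)`.
  set N : ℝ → ℝ := fun r => √(D r) * (‖f r‖ ^ 2 + ‖g r‖ ^ 2) * Real.exp (-(8 * K * √(b - r)))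
  have hN (r : ℝ) (hr : r ∈ Set.Ico r₀ b) : ∃ N', HasDerivAt N N' r ∧ 0 ≤ N' := by
    refine ⟨_, ((((hD r hr).sqrt (hD0 r hr).ne').mul ((hf r hr).norm_sq.add
      (hg r hr).norm_sq)).mul (((hasDerivAt_sqrt_sub hr.2).const_mul (8 * K)).neg.exp)), ?_⟩
    have h1 := inner_le f f' h r
    have h2 := inner_le g g' h' r
    have h3 := mul_le_mul_of_nonneg_left (hfb r hr) (norm_nonneg (f r))
    have h4 := mul_le_mul_of_nonneg_left (hgb r hr) (norm_nonneg (g r))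
    have hq : 0 < √(b - r) := Real.sqrt_pos.2 (sub_pos.2 hr.2)
    have hs : 0 < √(D r) := Real.sqrt_pos.2 (hD0 r hr)
    have hDr := hD0 r hr
    have hss := Real.sq_sqrt hDr.le
    set S := ‖f r‖ ^ 2 + ‖g r‖ ^ 2 with hS
    set w := K / √(b - r) with hw
    have hw0 : 0 ≤ w := by positivity
    have h5 : w * (‖f r‖ + ‖g r‖) ^ 2 ≤ w * (2 * S) := by
      apply mul_le_mul_of_nonneg_left _ hw0
      nlinarith [sq_nonneg (‖f r‖ - ‖g r‖)]
    have h6 : -(D' r / (2 * D r)) * S - 4 * w * S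
        ≤ 2 * inner ℝ (f r) (f' r) + 2 * inner ℝ (g r) (g' r) := by
      have : D' r / (2 * D r) = 2 * (D' r / (4 * D r)) := by field_simp; norm_num
      rw [this, hS]
      rw [hS] at h5
      linarith
    have h7 : D' r / (2 * √(D r)) = √(D r) * (D' r / (2 * D r)) := by
      field_simp
      rw [hss]
    have h8 : -(8 * K * -(1 / (2 * √(b - r)))) = 4 * w := by rw [hw]; field_simp; ring
    simp only [Pi.add_apply, Pi.mul_apply, Pi.neg_apply]
    rw [h7, h8, ← hS]
    have h9 := mul_le_mul_of_nonneg_left h6 hs.le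
    have h10 : 0 ≤ √(D r) * (D' r / (2 * D r)) * S
        + √(D r) * (2 * inner ℝ (f r) (f' r) + 2 * inner ℝ (g r) (g' r))
        + √(D r) * S * (4 * w) := by linarith
    have := mul_nonneg h10 (Real.exp_pos (-(8 * K * √(b - r)))).le
    linarith
  have hmono : MonotoneOn N (Set.Ico r₀ b) := by
    refine monotoneOn_of_deriv_nonneg (convex_Ico _ _) (fun r hr => ?_) (fun r hr => ?_)
      fun r hr => ?_
    · obtain ⟨N', hN', -⟩ := hN r hr
      exact hN'.continuousAt.continuousWithinAt
    · obtain ⟨N', hN', -⟩ := hN r (interior_subset hr)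
      exact hN'.differentiableAt.differentiableWithinAt
    · obtain ⟨N', hN', h0⟩ := hN r (interior_subset hr)
      rwa [hN'.deriv]
  refine (hmono ⟨le_rfl, hr.1.trans_lt hr.2⟩ hr hr.1).trans ?_
  refine mul_le_of_le_one_right (by positivity) (Real.exp_le_one_iff.2 ?_)
  rw [neg_nonpos]
  positivity

namespace KNdS

/-! ### The radial equation along a meridian -/

variable {s : KNdS} {rc rm rp lam ω : ℝ} {k : ℤ} {Xp Xm Yp Ym : ℝ → ℂ}
  {ψ : (Fin 4 → ℝ) → (Fin 4 → ℂ)}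

/-- The sum of the absolute values of the zeroth-order coefficients that couple the components of
row `j` of the Dirac equation to the component `3 - j`. -/
def couplingBound (s : KNdS) (ω : ℝ) (k : ℤ) (x : Fin 4 → ℝ) : ℝ :=
  s.angularSpeed x * |s.angularCoeff x|
    + |s.a * Real.sin (x 2) * ω + s.E / Real.sin (x 2) * (k + 1 / 2)|
      / (s.U (x 1) (x 2) * s.angularSpeed x)
    + |x 1 * s.a * Real.sin (x 2) * s.angularSpeed x / (2 * s.U (x 1) (x 2))|
    + |s.P * Real.cos (x 2) / s.U (x 1) (x 2) / (Real.sin (x 2) * s.angularSpeed x)|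

/-- Row `j` of the Dirac equation as a radial equation for the component `j + 2`: besides the
singular coefficient `Δ₊'/(4Δ₊)` and an imaginary one, all coefficients are `O(Δ₊^{-1/2})`. -/
theorem exists_norm_radial_le (hsep : s.IsSeparated rm rp ω k Xp Xm Yp Ym ψ)
    (hs : s.IsNonExtreme rc rm rp) (hsol : s.IsDiracSolution rm rp lam ψ)
    {x : Fin 4 → ℝ} (hx : x ∈ exterior rm rp) (j : Fin 4) :
    ∃ h : ℝ, s.radialSpeed x * ‖fderiv ℝ ψ x ![0, 1, 0, 0] (j + 2)
      + (s.radialDeltaDeriv (x 1) / (4 * s.radialDelta (x 1)) : ℝ) * ψ x (j + 2)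
      - Complex.I * h * ψ x (j + 2)‖ ≤
      s.radialSpeed x * (x 1 / (2 * s.U (x 1) (x 2))) * ‖ψ x (j + 2)‖
      + s.angularSpeed x * ‖fderiv ℝ ψ x ![0, 0, 1, 0] j.rev‖
      + s.couplingBound ω k x * ‖ψ x j.rev‖ + |lam| * ‖ψ x j‖ := by
  have hr := hs.isRegular hx
  obtain ⟨hd, heq⟩ := hsol x hx
  have hR := hr.radialSpeed_pos
  have hT := hr.angularSpeed_pos
  have hU := hr.U_pos
  have hsin := hr.sin_pos
  have hj := congrFun heq j
  have e0 := hsep.fderiv_killing hs hx hd (v := s.frame 0 x) (by simp [frame]) (by simp [frame])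
    (j + 2)
  have e3 := hsep.fderiv_killing hs hx hd (v := s.frame 3 x) (by simp [frame]) (by simp [frame])
    j.rev
  have p0 : s.potential x (s.frame 0 x) = -(s.Q * x 1 / s.U (x 1) (x 2) / s.radialSpeed x) := by
    simp [potential, hr.formB_frame, hr.formC_frame, div_eq_mul_inv]
  have p1 : s.potential x (s.frame 1 x) = 0 := by
    simp [potential, hr.formB_frame, hr.formC_frame]
  have p2 : s.potential x (s.frame 2 x) = 0 := by
    simp [potential, hr.formB_frame, hr.formC_frame]
  have p3 : s.potential x (s.frame 3 x) =
      -(s.P * Real.cos (x 2) / s.U (x 1) (x 2) / (Real.sin (x 2) * s.angularSpeed x)) := by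
    simp [potential, hr.formB_frame, hr.formC_frame, div_eq_mul_inv]
  have hA : (∑ α : Fin 4, (s.potential x (s.frame α x) : ℂ) •
      (cliffordMatrix α).mulVec (ψ x)) j =
      (s.Q * x 1 / s.U (x 1) (x 2) / s.radialSpeed x : ℝ) * ψ x (j + 2)
      - Complex.I * ![1, -1, -1, 1] j *
        (s.P * Real.cos (x 2) / s.U (x 1) (x 2) / (Real.sin (x 2) * s.angularSpeed x) : ℝ)
        * ψ x j.rev := by
    rw [Fin.sum_univ_four, p0, p1, p2, p3]
    simp only [cliffordMatrix_mulVec]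
    fin_cases j <;> simp [Fin.rev] <;> ring
  simp only [Pi.add_apply, Pi.smul_apply, hr.diracOp_apply, hA, e0, e3, frame_one, frame_two,
    map_smul, Pi.zero_apply] at hj
  have hη : s.couplingBound ω k x = s.angularSpeed x * |s.angularCoeff x|
      + |ω * s.frame 3 x 0 + (k + 1 / 2) * s.frame 3 x 3|
      + |x 1 * s.a * Real.sin (x 2) * s.angularSpeed x / (2 * s.U (x 1) (x 2))|
      + |s.P * Real.cos (x 2) / s.U (x 1) (x 2) / (Real.sin (x 2) * s.angularSpeed x)| := by
    rw [couplingBound, ← abs_of_pos (mul_pos hU hT), ← abs_div,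
      ← abs_neg ((_ + _) / _), hr.frame_three]
    congr 4
    simp
    field_simp
    ring
  -- The signs of the Clifford matrices enter only through their moduli, apart from `ε`, which has to
  -- be divided out, and `n`, which has to be real.
  obtain ⟨ε, hε, hε2⟩ : ∃ ε : ℝ, (![-1, 1, 1, -1] : Fin 4 → ℂ) j = ε ∧ ε * ε = 1 :=
    ⟨![-1, 1, 1, -1] j, by fin_cases j <;> simp, by fin_cases j <;> simp⟩
  obtain ⟨n, hn⟩ : ∃ n : ℝ, (![-1, 1, -1, 1] : Fin 4 → ℂ) j = n :=
    ⟨![-1, 1, -1, 1] j, by fin_cases j <;> simp⟩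
  have hτ : ‖(![1, 1, -1, -1] : Fin 4 → ℂ) j‖ = 1 := by fin_cases j <;> simp
  have hκ : ‖(![1, -1, -1, 1] : Fin 4 → ℂ) j‖ = 1 := by fin_cases j <;> simp
  rw [hε, hn] at hj
  rw [hη]
  generalize (![1, 1, -1, -1] : Fin 4 → ℂ) j = τ at hτ hj
  generalize (![1, -1, -1, 1] : Fin 4 → ℂ) j = κ at hκ hj
  generalize ω * s.frame 0 x 0 + (k + 1 / 2) * s.frame 0 x 3 = η₀ at hj
  generalize ω * s.frame 3 x 0 + (k + 1 / 2) * s.frame 3 x 3 = η₃ at hj ⊢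
  generalize x 1 * s.a * Real.sin (x 2) * s.angularSpeed x / (2 * s.U (x 1) (x 2)) = c₁ at hj ⊢
  generalize s.P * Real.cos (x 2) / s.U (x 1) (x 2) / (Real.sin (x 2) * s.angularSpeed x) = c₂
    at hj ⊢
  generalize s.Q * x 1 / s.U (x 1) (x 2) / s.radialSpeed x = c₃ at hj
  generalize s.a * Real.cos (x 2) * s.radialSpeed x / (2 * s.U (x 1) (x 2)) = c₄ at hj
  rw [radialCoeff] at hj
  have hu : 0 ≤ x 1 / (2 * s.U (x 1) (x 2)) := by have := hr.r_pos; positivity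
  generalize x 1 / (2 * s.U (x 1) (x 2)) = u at hu hj ⊢
  generalize s.radialDeltaDeriv (x 1) / (4 * s.radialDelta (x 1)) = δ at hj ⊢
  generalize s.radialSpeed x = R at hR hj ⊢
  generalize s.angularSpeed x = T at hT hj ⊢
  generalize s.angularCoeff x = β at hj ⊢
  generalize fderiv ℝ ψ x ![0, 1, 0, 0] = dr at hj ⊢
  generalize fderiv ℝ ψ x ![0, 0, 1, 0] = dθ at hj ⊢
  generalize ψ x (j + 2) = w at hj ⊢
  generalize ψ x j.rev = v at hj ⊢
  generalize ψ x j = z at hj ⊢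
  have hεn : ‖(ε : ℂ)‖ = 1 := by
    rw [Complex.norm_real, Real.norm_eq_abs]
    nlinarith [abs_mul_abs_self ε, abs_nonneg ε]
  have hε2' : (ε : ℂ) * ε = 1 := by exact_mod_cast hε2
  -- All terms that are imaginary multiples of the component `j + 2`: from `e₀`, from the connection
  -- and from the potential.
  obtain ⟨h, hh⟩ : ∃ h : ℝ, R * h = -(ε * (η₀ + n * c₄ + c₃)) :=
    ⟨-(ε * (η₀ + n * c₄ + c₃)) / R, by field_simp⟩
  have hh' : (R : ℂ) * h = -(ε * (η₀ + n * c₄ + c₃)) := by exact_mod_cast hh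
  refine ⟨h, ?_⟩
  have key : (R : ℂ) * (dr (j + 2) + (δ : ℝ) * w - Complex.I * h * w) =
      -(R * u * w) - ε * (τ * T * dθ j.rev + (τ * T * β * v + κ * η₃ * v + Complex.I * c₁ * v
        + κ * c₂ * v) + Complex.I * lam * z) := by
    simp only [Complex.real_smul, smul_eq_mul] at hj
    push_cast at hj ⊢
    linear_combination (ε : ℂ) * hj - (R * dr (j + 2) + R * δ * w + R * u * w) * hε2'
      + (ε * κ * η₃ * v + ε * κ * c₂ * v) * Complex.I_mul_I
      - Complex.I * w * hh'
  have hRn : ‖(R : ℂ)‖ = R := by rw [Complex.norm_real, Real.norm_of_nonneg hR.le]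
  have hTn : ‖(T : ℂ)‖ = T := by rw [Complex.norm_real, Real.norm_of_nonneg hT.le]
  have hun : ‖(u : ℂ)‖ = u := by rw [Complex.norm_real, Real.norm_of_nonneg hu]
  calc R * ‖dr (j + 2) + (δ : ℝ) * w - Complex.I * h * w‖
      = ‖-(R * u * w) - ε * (τ * T * dθ j.rev + (τ * T * β * v + κ * η₃ * v
        + Complex.I * c₁ * v + κ * c₂ * v) + Complex.I * lam * z)‖ := by
        rw [← key, norm_mul, hRn]
    _ ≤ ‖(R * u * w : ℂ)‖ + ‖τ * T * dθ j.rev + (τ * T * β * v + κ * η₃ * v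
        + Complex.I * c₁ * v + κ * c₂ * v) + Complex.I * lam * z‖ := by
        refine (norm_sub_le _ _).trans ?_
        rw [norm_neg, norm_mul (ε : ℂ), hεn, one_mul]
    _ ≤ ‖(R * u * w : ℂ)‖ + (‖τ * T * dθ j.rev‖ + (‖τ * T * β * v‖ + ‖κ * η₃ * v‖
        + ‖Complex.I * c₁ * v‖ + ‖κ * c₂ * v‖) + ‖Complex.I * lam * z‖) := by
        gcongr
        refine (norm_add₃_le).trans ?_
        gcongr
        refine (norm_add_le _ _).trans ?_
        gcongr
        exact norm_add₃_le
    _ = _ := by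
        simp only [norm_mul, hRn, hTn, hun, hτ, hκ, Complex.norm_I, Complex.norm_real,
          Real.norm_eq_abs]
        ring

end KNdS

namespace KNdS

/-! ### Behaviour of the radial factors at the cosmological horizon -/

variable {s : KNdS} {rc rm rp lam ω : ℝ} {k : ℤ} {Xp Xm Yp Ym : ℝ → ℂ}
  {ψ : (Fin 4 → ℝ) → (Fin 4 → ℂ)}

theorem IsNonExtreme.exists_mul_le_radialDelta (hs : s.IsNonExtreme rc rm rp) {r₀ : ℝ}
    (hr₀ : rm < r₀) : ∃ c, 0 < c ∧ ∀ r ∈ Set.Ico r₀ rp, c * (rp - r) ≤ s.radialDelta r := by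
  have h1 := hs.kappa_pos
  have h2 := hs.rc_pos
  have h3 := hs.rc_lt_rm
  have h4 := hs.rm_lt_rp
  have h5 : 0 < r₀ - rm := by linarith
  have h6 : 0 < r₀ - rc := by linarith
  have h7 : 0 < r₀ + (rc + rm + rp) := by linarith
  refine ⟨s.kappa ^ 2 * (r₀ - rm) * (r₀ - rc) * (r₀ + (rc + rm + rp)), by positivity,
    fun r hr => ?_⟩
  have h8 : 0 ≤ rp - r := by linarith [hr.2]
  have h9 : 0 ≤ r - rm := by linarith [hr.1]
  have h10 : 0 ≤ r - rc := by linarith [hr.1]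
  calc s.kappa ^ 2 * (r₀ - rm) * (r₀ - rc) * (r₀ + (rc + rm + rp)) * (rp - r)
      ≤ s.kappa ^ 2 * (r - rm) * (r - rc) * (r + (rc + rm + rp)) * (rp - r) := by
        gcongr <;> linarith [hr.1]
    _ = s.radialDelta r := by rw [hs.radialDelta_eq]; ring

theorem IsNonExtreme.exists_radialDelta_le (hs : s.IsNonExtreme rc rm rp) :
    ∃ C, 0 < C ∧ ∀ r ∈ Set.Ioo rm rp, s.radialDelta r ≤ C * (rp - r) := by
  have h1 := hs.kappa_pos
  have h2 := hs.rc_pos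
  have h3 := hs.rc_lt_rm
  have h4 := hs.rm_lt_rp
  have h5 : 0 < rp - rm := by linarith
  have h6 : 0 < rp - rc := by linarith
  have h7 : 0 < rp + (rc + rm + rp) := by linarith
  refine ⟨s.kappa ^ 2 * (rp - rm) * (rp - rc) * (rp + (rc + rm + rp)), by positivity,
    fun r hr => ?_⟩
  have h8 : 0 ≤ rp - r := by linarith [hr.2]
  have h9 : 0 ≤ r - rm := by linarith [hr.1]
  have h10 : 0 ≤ r - rc := by linarith [hr.1]
  have h11 : 0 ≤ r + (rc + rm + rp) := by linarith [hr.1]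
  calc s.radialDelta r
      = s.kappa ^ 2 * (r - rm) * (r - rc) * (r + (rc + rm + rp)) * (rp - r) := by
        rw [hs.radialDelta_eq]; ring
    _ ≤ _ := by gcongr <;> linarith [hr.2]

/-- The coefficients of the radial equation are bounded along a meridian up to the cosmological
horizon. -/
theorem exists_coeff_le (s : KNdS) (ω : ℝ) (k : ℤ) {r₀ : ℝ} (hr₀ : 0 < r₀) (rp t φ : ℝ) {θ : ℝ}
    (hθ : θ ∈ Set.Ioo 0 Real.pi) :
    ∃ C, 0 ≤ C ∧ ∀ r ∈ Set.Icc r₀ rp,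
      s.radialSpeed (slicePoint t (r, θ, φ)) * (r / (2 * s.U r θ)) ≤ C ∧
      s.angularSpeed (slicePoint t (r, θ, φ)) ≤ C ∧
      s.couplingBound ω k (slicePoint t (r, θ, φ)) ≤ C := by
  have hU0 : ∀ r ∈ Set.Icc r₀ rp, s.U r θ ≠ 0 := fun r hr => (s.U_pos (hr₀.trans_le hr.1) θ).ne'
  have hsin : Real.sin θ ≠ 0 := (Real.sin_pos_of_pos_of_lt_pi hθ.1 hθ.2).ne'
  have hU : ContinuousOn (fun r => s.U r θ) (Set.Icc r₀ rp) := by unfold U; fun_prop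
  have hUi := hU.inv₀ hU0
  have hT : ContinuousOn (fun r => s.angularSpeed (slicePoint t (r, θ, φ))) (Set.Icc r₀ rp) := by
    change ContinuousOn (fun r => √(s.angularDelta θ / s.U r θ)) _
    exact (continuousOn_const.div hU hU0).sqrt
  have hT0 : ∀ r ∈ Set.Icc r₀ rp, s.angularSpeed (slicePoint t (r, θ, φ)) ≠ 0 := fun r hr =>
    (Real.sqrt_pos.2 (div_pos (s.angularDelta_pos θ) (s.U_pos (hr₀.trans_le hr.1) θ))).ne'
  have hTi := hT.inv₀ hT0
  have hD : ContinuousOn s.radialDelta (Set.Icc r₀ rp) := by unfold radialDelta; fun_prop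
  have hR : ContinuousOn (fun r => s.radialSpeed (slicePoint t (r, θ, φ))) (Set.Icc r₀ rp) := by
    change ContinuousOn (fun r => √(s.radialDelta r / s.U r θ)) _
    exact (hD.div hU hU0).sqrt
  have c1 : ContinuousOn (fun r => s.radialSpeed (slicePoint t (r, θ, φ)) * (r / (2 * s.U r θ)))
      (Set.Icc r₀ rp) :=
    hR.mul (continuousOn_id.div (continuousOn_const.mul hU)
      fun r hr => mul_ne_zero two_ne_zero (hU0 r hr))
  have hβ : ContinuousOn (fun r => s.angularCoeff (slicePoint t (r, θ, φ))) (Set.Icc r₀ rp) := by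
    have hc (c : ℝ) : ContinuousOn (fun r => c / s.U r θ) (Set.Icc r₀ rp) :=
      continuousOn_const.div hU hU0
    exact (hc (-(s.a ^ 2 * Real.cos θ * Real.sin θ))).sub ((ContinuousOn.sub
      (continuousOn_const (c := s.kappa ^ 2 * s.a ^ 2 * Real.cos θ * Real.sin θ / s.angularDelta θ
        - Real.cos θ / Real.sin θ)) (hc (s.a ^ 2 * Real.cos θ * Real.sin θ))).div_const 2)
  have c2 : ContinuousOn (fun r => s.couplingBound ω k (slicePoint t (r, θ, φ)))
      (Set.Icc r₀ rp) := by
    have d1 : ContinuousOn (fun r => |s.a * Real.sin θ * ω + s.E / Real.sin θ * (k + 1 / 2)|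
        / (s.U r θ * s.angularSpeed (slicePoint t (r, θ, φ)))) (Set.Icc r₀ rp) :=
      continuousOn_const.div (hU.mul hT) fun r hr => mul_ne_zero (hU0 r hr) (hT0 r hr)
    have d2 : ContinuousOn (fun r => r * s.a * Real.sin θ *
        s.angularSpeed (slicePoint t (r, θ, φ)) / (2 * s.U r θ)) (Set.Icc r₀ rp) :=
      (((continuousOn_id.mul continuousOn_const).mul continuousOn_const).mul hT).div
        (continuousOn_const.mul hU) fun r hr => mul_ne_zero two_ne_zero (hU0 r hr)
    have d3 : ContinuousOn (fun r => s.P * Real.cos θ / s.U r θ /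
        (Real.sin θ * s.angularSpeed (slicePoint t (r, θ, φ)))) (Set.Icc r₀ rp) :=
      (continuousOn_const.div hU hU0).div (continuousOn_const.mul hT) fun r hr =>
        mul_ne_zero hsin (hT0 r hr)
    exact (((hT.mul hβ.abs).add d1).add d2.abs).add d3.abs
  obtain ⟨C1, h1⟩ := isCompact_Icc.exists_bound_of_continuousOn c1
  obtain ⟨C2, h2⟩ := isCompact_Icc.exists_bound_of_continuousOn c2
  obtain ⟨C3, h3⟩ := isCompact_Icc.exists_bound_of_continuousOn hT
  refine ⟨|C1| + |C2| + |C3|, by positivity, fun r hr => ⟨?_, ?_, ?_⟩⟩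
  · linarith [le_abs_self C1, abs_nonneg C2, abs_nonneg C3, (Real.le_norm_self _).trans (h1 r hr)]
  · linarith [le_abs_self C3, abs_nonneg C2, abs_nonneg C1, (Real.le_norm_self _).trans (h3 r hr)]
  · linarith [le_abs_self C2, abs_nonneg C1, abs_nonneg C3, (Real.le_norm_self _).trans (h2 r hr)]

/-- As `rp` is a simple root of `Δ₊`, the reciprocal of the radial speed is integrable up to it. -/
theorem IsNonExtreme.exists_inv_radialSpeed_le (hs : s.IsNonExtreme rc rm rp) {r₀ : ℝ}
    (hr₀ : rm < r₀) (t θ φ : ℝ) :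
    ∃ C, 0 ≤ C ∧ ∀ r ∈ Set.Ico r₀ rp,
      (s.radialSpeed (slicePoint t (r, θ, φ)))⁻¹ ≤ C / √(rp - r) := by
  obtain ⟨c, hc, hcr⟩ := hs.exists_mul_le_radialDelta hr₀
  refine ⟨√((rp ^ 2 + s.a ^ 2) / c), by positivity, fun r hr => ?_⟩
  have hr0 : 0 < r := ((hs.rc_pos.trans hs.rc_lt_rm).trans hr₀).trans_le hr.1
  have hq : 0 < rp - r := sub_pos.2 hr.2
  have hD : 0 < s.radialDelta r := hs.radialDelta_pos (hr₀.trans_le hr.1) hr.2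
  have hU : s.U r θ ≤ rp ^ 2 + s.a ^ 2 := by
    rw [U_eq_sub]
    have := pow_le_pow_left₀ hr0.le hr.2.le 2
    nlinarith [mul_nonneg (sq_nonneg s.a) (sq_nonneg (Real.sin θ))]
  rw [← Real.sqrt_div (by positivity)]
  change (√(s.radialDelta r / s.U r θ))⁻¹ ≤ _
  rw [← Real.sqrt_inv, inv_div, div_div]
  exact Real.sqrt_le_sqrt (div_le_div₀ (by positivity) hU (by positivity) (hcr r hr))

/-- The radial equation along a meridian, with a coefficient that is integrable up to the
cosmological horizon. -/
theorem exists_norm_radial_le_div_sqrt (hsep : s.IsSeparated rm rp ω k Xp Xm Yp Ym ψ)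
    (hs : s.IsNonExtreme rc rm rp) (hsol : s.IsDiracSolution rm rp lam ψ) {r₀ t θ φ : ℝ}
    (hr₀ : rm < r₀) (hθ : θ ∈ Set.Ioo 0 Real.pi) {j : Fin 4}
    (hY : angularFactor Yp Ym j θ ≠ 0) :
    ∃ K, 0 ≤ K ∧ ∀ r ∈ Set.Ico r₀ rp, ∃ h : ℝ,
      ‖fderiv ℝ ψ (slicePoint t (r, θ, φ)) ![0, 1, 0, 0] (j + 2)
        + (s.radialDeltaDeriv r / (4 * s.radialDelta r) : ℝ) * ψ (slicePoint t (r, θ, φ)) (j + 2)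
        - Complex.I * h * ψ (slicePoint t (r, θ, φ)) (j + 2)‖
      ≤ K / √(rp - r) *
        (‖ψ (slicePoint t (r, θ, φ)) j‖ + ‖ψ (slicePoint t (r, θ, φ)) (j + 2)‖) := by
  have hr₀' : 0 < r₀ := (hs.rc_pos.trans hs.rc_lt_rm).trans hr₀
  obtain ⟨C₀, hC₀, h0⟩ := s.exists_coeff_le ω k hr₀' rp t φ hθ
  obtain ⟨C₁, hC₁, h1⟩ := hsep.exists_norm_rev_le hs (fun x hx => (hsol x hx).1) (t := t) (φ := φ)
    hθ hY
  obtain ⟨C₂, hC₂, h2⟩ := hs.exists_inv_radialSpeed_le hr₀ t θ φ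
  refine ⟨C₂ * (C₀ + 2 * (C₀ * C₁) + |lam|), by positivity, fun r hr => ?_⟩
  have hr' : r ∈ Set.Ioo rm rp := ⟨hr₀.trans_le hr.1, hr.2⟩
  have hx := slicePoint_mem_exterior (t := t) (φ := φ) hr' hθ
  obtain ⟨h, hh⟩ := exists_norm_radial_le hsep hs hsol hx j
  refine ⟨h, ?_⟩
  obtain ⟨a1, a2, a3⟩ := h0 r ⟨hr.1, hr.2.le⟩
  obtain ⟨b1, b2⟩ := h1 r hr'
  have hR := (hs.isRegular hx).radialSpeed_pos
  have hRi := h2 r hr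
  have hT := (hs.isRegular hx).angularSpeed_pos
  set x := slicePoint t (r, θ, φ) with hxdef
  have e1 : x 1 = r := rfl
  have e2 : x 2 = θ := rfl
  rw [e1, e2] at hh
  have i1 := mul_le_mul_of_nonneg_right a1 (norm_nonneg (ψ x (j + 2)))
  have i2 := mul_le_mul a2 b2 (norm_nonneg _) hC₀
  have i3 := mul_le_mul a3 b1 (norm_nonneg _) hC₀
  have i4 : 0 ≤ (2 * (C₀ * C₁) + |lam|) * ‖ψ x (j + 2)‖ := by positivity
  have i5 : 0 ≤ C₀ * ‖ψ x j‖ := by positivity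
  have i6 := hh.trans (show _ ≤ (C₀ + 2 * (C₀ * C₁) + |lam|) * (‖ψ x j‖ + ‖ψ x (j + 2)‖) by
    linarith)
  rw [← le_inv_mul_iff₀ hR] at i6
  refine i6.trans ?_
  calc (s.radialSpeed x)⁻¹ * ((C₀ + 2 * (C₀ * C₁) + |lam|) * (‖ψ x j‖ + ‖ψ x (j + 2)‖))
      ≤ C₂ / √(rp - r) * ((C₀ + 2 * (C₀ * C₁) + |lam|) * (‖ψ x j‖ + ‖ψ x (j + 2)‖)) := by
        gcongr
    _ = _ := by ring

theorem fin_four_add_two_add_two (j : Fin 4) : j + 2 + 2 = j := by fin_cases j <;> rfl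

/-- The radial factors of a separated solution stay away from `0` at the cosmological horizon,
unless they vanish. -/
theorem exists_le_norm_radialFactor (hsep : s.IsSeparated rm rp ω k Xp Xm Yp Ym ψ)
    (hs : s.IsNonExtreme rc rm rp) (hsol : s.IsDiracSolution rm rp lam ψ) {r₀ θ : ℝ}
    (hr₀ : r₀ ∈ Set.Ioo rm rp) (hθ : θ ∈ Set.Ioo 0 Real.pi) {j : Fin 4}
    (hY : angularFactor Yp Ym j θ ≠ 0) (hX : radialFactor Xp Xm j r₀ ≠ 0) :
    ∃ c, 0 < c ∧ ∀ r ∈ Set.Ico r₀ rp,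
      c ≤ ‖radialFactor Xp Xm j r‖ ^ 2 + ‖radialFactor Xp Xm (j + 2) r‖ ^ 2 := by
  have hr₀' : 0 < r₀ := (hs.rc_pos.trans hs.rc_lt_rm).trans hr₀.1
  have hY' : angularFactor Yp Ym (j + 2) θ ≠ 0 := by rwa [angularFactor_add_two]
  obtain ⟨K, hK, hg⟩ := exists_norm_radial_le_div_sqrt hsep hs hsol (t := 0) (φ := 0) hr₀.1 hθ hY
  obtain ⟨K', hK', hf⟩ := exists_norm_radial_le_div_sqrt hsep hs hsol (t := 0) (φ := 0) hr₀.1 hθ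
    hY'
  rw [fin_four_add_two_add_two] at hf
  choose! h hg using hg
  choose! h' hf using hf
  have hmem (r : ℝ) (hr : r ∈ Set.Ico r₀ rp) : slicePoint 0 (r, θ, 0) ∈ exterior rm rp :=
    slicePoint_mem_exterior ⟨hr₀.1.trans_le hr.1, hr.2⟩ hθ
  have hd (r : ℝ) (hr : r ∈ Set.Ico r₀ rp) := (hsol _ (hmem r hr)).1
  have hDpos (r : ℝ) (hr : r ∈ Set.Ico r₀ rp) := hs.radialDelta_pos (hr₀.1.trans_le hr.1) hr.2
  have hUpos (r : ℝ) (hr : r ∈ Set.Ico r₀ rp) := s.U_pos (hr₀'.trans_le hr.1) θ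
  have hYn : 0 < ‖angularFactor Yp Ym j θ‖ := norm_pos_iff.2 hY
  -- The quantity controlled by the radial system, in terms of the radial factors.
  have hN (r : ℝ) (hr : r ∈ Set.Ico r₀ rp) : √(s.radialDelta r) *
      (‖ψ (slicePoint 0 (r, θ, 0)) j‖ ^ 2 + ‖ψ (slicePoint 0 (r, θ, 0)) (j + 2)‖ ^ 2)
      = (‖radialFactor Xp Xm j r‖ ^ 2 + ‖radialFactor Xp Xm (j + 2) r‖ ^ 2)
        * ‖angularFactor Yp Ym j θ‖ ^ 2 / √(s.U r θ) := by
    have h1 := Real.sqrt_pos.2 (hDpos r hr)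
    have h2 := Real.sqrt_pos.2 (hUpos r hr)
    rw [hsep.norm_apply_sq hs (hmem r hr), hsep.norm_apply_sq hs (hmem r hr),
      angularFactor_add_two, show slicePoint 0 (r, θ, 0) 1 = r from rfl,
      show slicePoint 0 (r, θ, 0) 2 = θ from rfl]
    field_simp
  have hmain (r : ℝ) (hr : r ∈ Set.Ico r₀ rp) :=
    le_sqrt_mul_norm_sq_add_norm_sq (K := K + K') (D := s.radialDelta) (h := h') (h' := h)
      (by positivity)
      (fun r _ => s.hasDerivAt_radialDelta r) hDpos
      (fun r hr => hasDerivAt_radial (hd r hr) j) (fun r hr => hasDerivAt_radial (hd r hr) (j + 2))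
      (fun r hr => (hf r hr).trans (by
        rw [add_comm ‖ψ _ (j + 2)‖]
        gcongr
        linarith))
      (fun r hr => (hg r hr).trans (by gcongr; linarith)) hr
  have hr₀m : r₀ ∈ Set.Ico r₀ rp := ⟨le_rfl, hr₀.2⟩
  have hXn : 0 < ‖radialFactor Xp Xm j r₀‖ := norm_pos_iff.2 hX
  have hU₀ := hUpos r₀ hr₀m
  refine ⟨(‖radialFactor Xp Xm j r₀‖ ^ 2 + ‖radialFactor Xp Xm (j + 2) r₀‖ ^ 2)
    / √(s.U r₀ θ) * Real.exp (-(8 * (K + K') * √(rp - r₀))) * r₀, by positivity, fun r hr => ?_⟩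
  have hm := hmain r hr
  rw [hN r hr, hN r₀ hr₀m] at hm
  have hUr : r₀ ≤ √(s.U r θ) := by
    apply Real.le_sqrt_of_sq_le
    have := pow_le_pow_left₀ hr₀'.le hr.1 2
    have : 0 ≤ s.a ^ 2 * Real.cos θ ^ 2 := by positivity
    unfold U
    linarith
  have hU := Real.sqrt_pos.2 (hUpos r hr)
  rw [le_div_iff₀ hU] at hm
  refine le_of_mul_le_mul_right ?_ (pow_pos hYn 2)
  refine le_trans (le_trans (le_of_eq ?_) (mul_le_mul_of_nonneg_left hUr ?_)) hm
  · ring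
  · positivity

end KNdS

/-! ### Divergence of the `L^p` norm -/

theorem lintegral_ofReal_div_sub_eq_top {a b c : ℝ} (hab : a < b) (hc : 0 < c) :
    ∫⁻ r in Set.Ioo a b, ENNReal.ofReal (c / (b - r)) = ⊤ := by
  by_contra hfin
  have hpos : ∀ᵐ r ∂volume.restrict (Set.Ioo a b), 0 ≤ c / (b - r) := by
    filter_upwards [ae_restrict_mem measurableSet_Ioo] with r hr
    exact div_nonneg hc.le (sub_nonneg.2 hr.2.le)
  have hint : IntegrableOn (fun r => c / (b - r)) (Set.Ioo a b) :=
    (lintegral_ofReal_ne_top_iff_integrable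
      (Measurable.aestronglyMeasurable (by fun_prop)) hpos).1 hfin
  have h2 : IntervalIntegrable (fun r => (r - b)⁻¹) volume a b := by
    rw [intervalIntegrable_iff_integrableOn_Ioo_of_le hab.le]
    refine (hint.const_mul (-c⁻¹)).congr (Eventually.of_forall fun r => ?_)
    have : r - b = -(b - r) := by ring
    simp only [this, inv_neg, div_eq_mul_inv]
    field_simp
  rw [intervalIntegrable_sub_inv_iff] at h2
  rcases h2 with h | h
  · exact hab.ne h
  · exact h Set.right_mem_uIcc

theorem lintegral_box_ofReal_div_sub_eq_top {a b c θ₁ θ₂ L : ℝ} (hab : a < b) (hc : 0 < c)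
    (hθ : θ₁ < θ₂) (hL : 0 < L) :
    ∫⁻ y in Set.Ioo a b ×ˢ Set.Ioo θ₁ θ₂ ×ˢ Set.Ioo 0 L,
      ENNReal.ofReal (c / (b - (y : ℝ × ℝ × ℝ).1)) = ⊤ := by
  have hm : AEMeasurable (fun r => ENNReal.ofReal (c / (b - r))) (volume.restrict (Set.Ioo a b)) :=
    Measurable.aemeasurable (by fun_prop)
  have h := lintegral_prod_mul hm (ν := (volume : Measure (ℝ × ℝ)).restrict
    (Set.Ioo θ₁ θ₂ ×ˢ Set.Ioo 0 L)) (g := fun _ => 1) aemeasurable_const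
  rw [lintegral_ofReal_div_sub_eq_top hab hc, Measure.prod_restrict, ← Measure.volume_eq_prod] at h
  simp only [mul_one] at h
  rw [h]
  simp [Measure.volume_eq_prod, hθ, hL]

/-- The singularities `(b - r)^{-1/2}` of `|F|²` and of the volume density at `r = b` add up to a
divergent integral `∫ |F|^p` as soon as `p ≥ 2`. -/
theorem not_memLp_of_le_norm_sq {G : Type*} [NormedAddCommGroup G] {F : ℝ × ℝ × ℝ → G}
    {ρ : ℝ × ℝ × ℝ → ℝ} {S : Set (ℝ × ℝ × ℝ)} {a b θ₁ θ₂ L c d p : ℝ} (hab : a < b)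
    (hab' : b - a ≤ 1) (hθ : θ₁ < θ₂) (hL : 0 < L) (hc : 0 < c) (hd : 0 < d) (hp : 2 ≤ p)
    (hS : Set.Ioo a b ×ˢ Set.Ioo θ₁ θ₂ ×ˢ Set.Ioo 0 L ⊆ S)
    (hF : ∀ y ∈ Set.Ioo a b ×ˢ Set.Ioo θ₁ θ₂ ×ˢ Set.Ioo 0 L, c / √(b - y.1) ≤ ‖F y‖ ^ 2)
    (hρ : ∀ y ∈ Set.Ioo a b ×ˢ Set.Ioo θ₁ θ₂ ×ˢ Set.Ioo 0 L, d / √(b - y.1) ≤ ρ y) :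
    ¬ MemLp F (ENNReal.ofReal p)
      ((volume.restrict S).withDensity fun y => ENNReal.ofReal (ρ y)) := by
  intro h
  set B := Set.Ioo a b ×ˢ Set.Ioo θ₁ θ₂ ×ˢ Set.Ioo 0 L with hB
  have hBm : MeasurableSet B :=
    measurableSet_Ioo.prod (measurableSet_Ioo.prod measurableSet_Ioo)
  set μ : Measure (ℝ × ℝ × ℝ) :=
    (volume.restrict B).withDensity fun y => ENNReal.ofReal (d / √(b - y.1)) with hμ
  have hle : μ ≤ (volume.restrict S).withDensity fun y => ENNReal.ofReal (ρ y) := by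
    calc μ ≤ (volume.restrict B).withDensity fun y => ENNReal.ofReal (ρ y) := by
          refine withDensity_mono ?_
          filter_upwards [ae_restrict_mem hBm] with y hy
          exact ENNReal.ofReal_le_ofReal (hρ y hy)
      _ = ((volume.restrict S).withDensity fun y => ENNReal.ofReal (ρ y)).restrict B := by
          rw [restrict_withDensity hBm, Measure.restrict_restrict_of_subset hS]
      _ ≤ _ := Measure.restrict_le_self
  have hp0 : 0 < p := by linarith
  have hfin := (eLpNorm_lt_top_iff_lintegral_rpow_enorm_lt_top
    (ENNReal.ofReal_pos.2 hp0).ne' ENNReal.ofReal_ne_top).1 (h.mono_measure hle).eLpNorm_lt_top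
  rw [ENNReal.toReal_ofReal hp0.le] at hfin
  have hlow : ∫⁻ y, ENNReal.ofReal (c ^ (p / 2) / √(b - y.1)) ∂μ ≤ ∫⁻ y, ‖F y‖ₑ ^ p ∂μ := by
    refine lintegral_mono_ae ?_
    filter_upwards [(withDensity_absolutelyContinuous (μ := volume.restrict B)
      (fun y => ENNReal.ofReal (d / √(b - y.1)))).ae_le (ae_restrict_mem hBm)] with y hy
    rw [← ofReal_norm, ENNReal.ofReal_rpow_of_nonneg (norm_nonneg _) hp0.le]
    apply ENNReal.ofReal_le_ofReal
    have h1 : 0 < b - y.1 := sub_pos.2 hy.1.2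
    have h2 : √(b - y.1) ≤ 1 := Real.sqrt_le_one.2 (by linarith [hy.1.1])
    have h3 : 0 < √(b - y.1) := Real.sqrt_pos.2 h1
    -- This is where `p ≥ 2` enters.
    calc c ^ (p / 2) / √(b - y.1) ≤ c ^ (p / 2) / √(b - y.1) ^ (p / 2) := by
          gcongr
          calc √(b - y.1) ^ (p / 2) ≤ √(b - y.1) ^ (1 : ℝ) :=
                Real.rpow_le_rpow_of_exponent_ge h3 h2 (by linarith)
            _ = _ := Real.rpow_one _
      _ = (c / √(b - y.1)) ^ (p / 2) := by rw [Real.div_rpow hc.le h3.le]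
      _ ≤ (‖F y‖ ^ 2) ^ (p / 2) := Real.rpow_le_rpow (by positivity) (hF y hy) (by positivity)
      _ = ‖F y‖ ^ p := by
          rw [← Real.rpow_natCast, ← Real.rpow_mul (norm_nonneg _)]
          congr 1
          push_cast
          ring
  rw [hμ, lintegral_withDensity_eq_lintegral_mul _ (by fun_prop) (by fun_prop)] at hlow
  have htop : ∫⁻ y in B, ENNReal.ofReal (d * c ^ (p / 2) / (b - y.1)) = ⊤ :=
    lintegral_box_ofReal_div_sub_eq_top hab (by positivity) hθ hL
  have heq : ∫⁻ y in B, ((fun y : ℝ × ℝ × ℝ => ENNReal.ofReal (d / √(b - y.1)))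
      * fun y : ℝ × ℝ × ℝ => ENNReal.ofReal (c ^ (p / 2) / √(b - y.1))) y = ⊤ := by
    rw [← htop]
    refine setLIntegral_congr_fun hBm fun y hy => ?_
    have h1 : 0 < b - y.1 := sub_pos.2 hy.1.2
    simp only [Pi.mul_apply]
    rw [← ENNReal.ofReal_mul (by positivity), div_mul_div_comm, Real.mul_self_sqrt h1.le]
  rw [heq] at hlow
  exact hfin.not_ge hlow

namespace KNdS

/-! ### The volume density of a time slice -/

variable {s : KNdS} {rc rm rp lam ω : ℝ} {k : ℤ} {Xp Xm Yp Ym : ℝ → ℂ}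
  {ψ : (Fin 4 → ℝ) → (Fin 4 → ℂ)}

/-- The factor in parentheses is proportional to `g_φφ`, which may be negative far from the horizon. -/
theorem sliceDensity_eq {t r θ φ : ℝ} (hx : s.IsRegular (slicePoint t (r, θ, φ))) :
    s.sliceDensity t (r, θ, φ) = √(s.U r θ * Real.sin θ ^ 2
      * (s.angularDelta θ * (r ^ 2 + s.a ^ 2) ^ 2
        - s.radialDelta r * s.a ^ 2 * Real.sin θ ^ 2)
      / (s.radialDelta r * s.angularDelta θ * s.E ^ 2)) := by
  have hU : 0 < s.U r θ := hx.U_pos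
  have hD : 0 < s.radialDelta r := hx.radialDelta_pos
  have hA := s.angularDelta_pos θ
  have hE := s.E_pos
  rw [sliceDensity, Matrix.det_fin_three]
  congr 1
  simp [metric, formB, formC, slicePoint]
  field_simp
  ring

/-- The volume density of a time slice blows up like `(rp - r)^{-1/2}` at the cosmological
horizon. -/
theorem IsNonExtreme.exists_le_sliceDensity (hs : s.IsNonExtreme rc rm rp) {r₀ σ : ℝ}
    (hr₀ : r₀ ∈ Set.Ioo rm rp) (hσ : 0 < σ) :
    ∃ r₂ ∈ Set.Ioo r₀ rp, ∃ d, 0 < d ∧ ∀ r ∈ Set.Ioo r₂ rp, ∀ θ, σ ≤ Real.sin θ → ∀ t φ,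
      d / √(rp - r) ≤ s.sliceDensity t (r, θ, φ) := by
  obtain ⟨C, hC, hCr⟩ := hs.exists_radialDelta_le
  have hr₀' : 0 < r₀ := (hs.rc_pos.trans hs.rc_lt_rm).trans hr₀.1
  have hE := s.E_pos
  -- For `rp - r < η` the term `-Δ₊(r) a² sin² θ` of `g_φφ` is at most half of the positive one.
  set η := r₀ ^ 4 / (2 * (C * (s.a ^ 2 + 1))) with hη
  have hη0 : 0 < η := by positivity
  refine ⟨max ((r₀ + rp) / 2) (rp - η), ⟨lt_max_of_lt_left (by linarith [hr₀.2]),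
    max_lt (by linarith [hr₀.2]) (by linarith)⟩,
    √(r₀ ^ 2 * σ ^ 2 * (r₀ ^ 4 / 2) / (C * s.E * s.E ^ 2)), by positivity,
    fun r hr θ hθ t φ => ?_⟩
  have h1 : r₀ < r := by linarith [le_max_left ((r₀ + rp) / 2) (rp - η), hr.1, hr₀.2]
  have h2 : rp - r < η := by linarith [le_max_right ((r₀ + rp) / 2) (rp - η), hr.1]
  have hq : 0 < rp - r := sub_pos.2 hr.2
  have hrr : r ∈ Set.Ioo rm rp := ⟨hr₀.1.trans h1, hr.2⟩
  have hD := hs.radialDelta_pos hrr.1 hrr.2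
  have hDC := hCr r hrr
  have hA := s.angularDelta_pos θ
  have hx : s.IsRegular (slicePoint t (r, θ, φ)) := ⟨hr₀'.trans h1, hD, hσ.trans_le hθ⟩
  rw [sliceDensity_eq hx, ← Real.sqrt_div (by positivity)]
  have hU : r₀ ^ 2 ≤ s.U r θ := by
    have := pow_le_pow_left₀ hr₀'.le h1.le 2
    have : 0 ≤ s.a ^ 2 * Real.cos θ ^ 2 := by positivity
    unfold U
    linarith
  have hU0 : 0 < s.U r θ := hx.U_pos
  have hA1 : 1 ≤ s.angularDelta θ := by
    unfold angularDelta
    have : 0 ≤ s.kappa ^ 2 * s.a ^ 2 * Real.cos θ ^ 2 := by positivity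
    linarith
  have hAE : s.angularDelta θ ≤ s.E := by
    unfold angularDelta E
    have := mul_le_of_le_one_right (mul_nonneg (sq_nonneg s.kappa) (sq_nonneg s.a))
      (Real.cos_sq_le_one θ)
    linarith
  have hb1 : r₀ ^ 4 ≤ s.angularDelta θ * (r ^ 2 + s.a ^ 2) ^ 2 := by
    have e1 : r₀ ^ 2 ≤ r ^ 2 + s.a ^ 2 := by
      have := pow_le_pow_left₀ hr₀'.le h1.le 2
      have := sq_nonneg s.a
      linarith
    calc r₀ ^ 4 = 1 * (r₀ ^ 2) ^ 2 := by ring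
      _ ≤ _ := by gcongr
  have hb2 : s.radialDelta r * s.a ^ 2 * Real.sin θ ^ 2 ≤ r₀ ^ 4 / 2 := by
    calc s.radialDelta r * s.a ^ 2 * Real.sin θ ^ 2 ≤ (C * η) * (s.a ^ 2 + 1) * 1 := by
          gcongr
          · exact hDC.trans (by gcongr)
          · linarith
          · exact Real.sin_sq_le_one θ
      _ = r₀ ^ 4 / 2 := by rw [hη]; field_simp
  have hb3 : r₀ ^ 4 / 2 ≤ s.angularDelta θ * (r ^ 2 + s.a ^ 2) ^ 2
      - s.radialDelta r * s.a ^ 2 * Real.sin θ ^ 2 := by linarith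
  apply Real.sqrt_le_sqrt
  rw [div_div]
  have hnum : 0 ≤ s.U r θ * Real.sin θ ^ 2 * (s.angularDelta θ * (r ^ 2 + s.a ^ 2) ^ 2
      - s.radialDelta r * s.a ^ 2 * Real.sin θ ^ 2) :=
    mul_nonneg (mul_nonneg hU0.le (sq_nonneg _)) ((by positivity : 0 ≤ r₀ ^ 4 / 2).trans hb3)
  refine div_le_div₀ hnum (by gcongr) (by positivity) ?_
  calc s.radialDelta r * s.angularDelta θ * s.E ^ 2 ≤ (C * (rp - r)) * s.E * s.E ^ 2 := by gcongr
    _ = _ := by ring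

end KNdS

end

open KNdS in
theorem mainTheorem1 (s : KNdS) (rc rm rp : ℝ) (hs : s.IsNonExtreme rc rm rp)
    (lam p : ℝ) (hp : 2 ≤ p) (ω : ℝ) (k : ℤ) (Xp Xm Yp Ym : ℝ → ℂ)
    (ψ : (Fin 4 → ℝ) → (Fin 4 → ℂ))
    (hsol : s.IsDiracSolution rm rp lam ψ)
    (hsep : s.IsSeparated rm rp ω k Xp Xm Yp Ym ψ)
    (hmatch : KNdS.HorizonMatching rm Xp Xm)
    (t₀ r₁ : ℝ) (hr₁ : rm < r₁ ∧ r₁ < rp)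
    (hLp : s.IsLpOnSlice p t₀ r₁ rp ψ) :
    ∀ x ∈ KNdS.exterior rm rp, ψ x = 0 := by
  by_contra! hne
  obtain ⟨x, hx, hψ⟩ := hne
  obtain ⟨j, hj⟩ := Function.ne_iff.1 hψ
  rw [hsep.apply hs hx] at hj
  have hj' := right_ne_zero_of_mul (right_ne_zero_of_mul hj)
  have hX : radialFactor Xp Xm j (x 1) ≠ 0 := left_ne_zero_of_mul hj'
  have hY : angularFactor Yp Ym j (x 2) ≠ 0 := right_ne_zero_of_mul hj'
  have hr : x 1 ∈ Set.Ioo rm rp := ⟨hx.1, hx.2.1⟩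
  have hθ : x 2 ∈ Set.Ioo 0 Real.pi := hx.2.2
  have hr0 : 0 < x 1 := (hs.isRegular hx).r_pos
  obtain ⟨c, hc, hcr⟩ := exists_le_norm_radialFactor hsep hs hsol hr hθ hY hX
  -- By continuity `Y_j` and `sin` are bounded below on a neighbourhood of `x 2`.
  have hYc : ContinuousAt (angularFactor Yp Ym j) (x 2) :=
    (hsep.differentiableAt_angularFactor hs hr hθ
      (hsol _ (slicePoint_mem_exterior (t := 0) (φ := 0) hr hθ)).1 hX).continuousAt
  have hYn : 0 < ‖angularFactor Yp Ym j (x 2)‖ := norm_pos_iff.2 hY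
  have hsin : 0 < Real.sin (x 2) := (hs.isRegular hx).sin_pos
  obtain ⟨θ₁, θ₂, hθ₁₂, hbox⟩ := mem_nhds_iff_exists_Ioo_subset.1
    (((hYc.norm.eventually_const_lt (half_lt_self hYn)).and
      (Real.continuous_sin.continuousAt.eventually_const_lt (half_lt_self hsin))).and
      (isOpen_Ioo.mem_nhds hθ))
  -- The box lies between `a` and `rp`, where `(rp - r)^{-p/4} ≥ (rp - r)^{-1/2}` by `rp - a ≤ 1`.
  obtain ⟨r₂, hr₂, d, hd, hdr⟩ := hs.exists_le_sliceDensity hr (half_pos hsin)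
  obtain ⟨C, hC, hCr⟩ := hs.exists_radialDelta_le
  set a := max (max r₂ r₁) (rp - 1) with ha
  have ha1 : r₂ ≤ a := (le_max_left _ _).trans (le_max_left _ _)
  have ha2 : r₁ ≤ a := (le_max_right _ _).trans (le_max_left _ _)
  have ha3 : rp - 1 ≤ a := le_max_right _ _
  have hab : a < rp := max_lt (max_lt hr₂.2 hr₁.2) (by linarith)
  set y₀ := ‖angularFactor Yp Ym j (x 2)‖ / 2 with hy₀
  have hy₀p : 0 < y₀ := half_pos hYn
  have hrp : 0 < rp := hr0.trans hr.2
  refine not_memLp_of_le_norm_sq (a := a) (b := rp) (θ₁ := θ₁) (θ₂ := θ₂) (L := 2 * Real.pi)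
    (c := c * y₀ ^ 2 / (√C * √(rp ^ 2 + s.a ^ 2))) (d := d) hab (by linarith)
    (hθ₁₂.1.trans hθ₁₂.2) Real.two_pi_pos (by positivity) hd hp ?_ ?_ ?_ hLp
  · exact Set.prod_mono (Set.Ioo_subset_Ioo_left ha2) (Set.prod_mono
      (fun θ h => (hbox h).2) subset_rfl)
  · rintro ⟨r, θ, φ⟩ ⟨hyr, hyθ, -⟩
    have hyr2 : r < rp := hyr.2
    have hxr : x 1 < r := hr₂.1.trans_le (ha1.trans hyr.1.le)
    have hr' : r ∈ Set.Ioo rm rp := ⟨hr.1.trans hxr, hyr2⟩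
    have hmem := slicePoint_mem_exterior (t := t₀) (φ := φ) hr' (hbox hyθ).2
    have hYθ : y₀ ≤ ‖angularFactor Yp Ym j θ‖ := (hbox hyθ).1.1.le
    have hX2 := hcr r ⟨hxr.le, hyr2⟩
    have hD := hs.radialDelta_pos hr'.1 hr'.2
    have hDC := hCr r hr'
    have hU := s.U_pos (hr0.trans hxr) θ
    have hUle : s.U r θ ≤ rp ^ 2 + s.a ^ 2 := by
      rw [U_eq_sub]
      have := pow_le_pow_left₀ (hr0.trans hxr).le hyr2.le 2
      nlinarith [mul_nonneg (sq_nonneg s.a) (sq_nonneg (Real.sin θ))]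
    have hq : 0 < rp - r := sub_pos.2 hyr2
    rw [EuclideanSpace.norm_sq_eq]
    calc c * y₀ ^ 2 / (√C * √(rp ^ 2 + s.a ^ 2)) / √(rp - r)
        = c * y₀ ^ 2 / (√(C * (rp - r)) * √(rp ^ 2 + s.a ^ 2)) := by
          rw [Real.sqrt_mul hC.le, div_div]
          ring_nf
      _ ≤ (‖radialFactor Xp Xm j r‖ ^ 2 + ‖radialFactor Xp Xm (j + 2) r‖ ^ 2)
          * ‖angularFactor Yp Ym j θ‖ ^ 2 / (√(s.radialDelta r) * √(s.U r θ)) := by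
          gcongr
      _ = ‖ψ (slicePoint t₀ (r, θ, φ)) j‖ ^ 2
          + ‖ψ (slicePoint t₀ (r, θ, φ)) (j + 2)‖ ^ 2 := by
          rw [hsep.norm_apply_sq hs hmem, hsep.norm_apply_sq hs hmem, angularFactor_add_two,
            add_mul, add_div]
          rfl
      _ ≤ ∑ i, ‖ψ (slicePoint t₀ (r, θ, φ)) i‖ ^ 2 := by
          rw [← Finset.sum_pair (f := fun i => ‖ψ (slicePoint t₀ (r, θ, φ)) i‖ ^ 2)
            (show j ≠ j + 2 by fin_cases j <;> decide)]
          exact Finset.sum_le_univ_sum_of_nonneg fun i => sq_nonneg _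
  · rintro ⟨r, θ, φ⟩ ⟨hyr, hyθ, -⟩
    exact hdr r ⟨ha1.trans_lt hyr.1, hyr.2⟩ θ (hbox hyθ).1.2.le t₀ φ
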